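/- Let $n\ge 2$, let $B_r\subset\mathbb{R}^n$ be the open ball of radius $r$ centered at $0$, and let $H^{n-1}$ be the $(n-1)$-dimensional Hausdorff measure, normalized to agree with Lebesgue measure on hyperplanes. Let $\Gamma\subset B_1$ be a smooth closed hypersurface (compact, embedded, without boundary) such that $\Gamma\cap B_{1/2}=\{x_n=0\}\cap B_{1/2}$. Let $\eta:(-1/2,1/2)\to\mathbb{R}$ be the continuous function $$\eta(t)=\begin{cases}\dfrac{1}{|\log t|}, & t\in(0,1/2),\\ 0, & t\in(-1/2,0],\end{cases}$$ and let $g\in L^\infty(\Gamma)$ (with respect to $H^{n-1}$) be any function such that $g(x)=\eta(x_1)$ for all $x\in\Gamma\cap B_{1/2}$. (For example, $g$ may be continuous on $\Gamma$, or smooth on $\Gamma\setminus B_{1/2}$; neither is required.) Call $u\in C(\overline{B_1})$ a distributional solution of $$\Delta u=g\,dH^{n-1}\llcorner\Gamma\ \text{ in } B_1,\qquad u=0\ \text{ on }\partial B_1,$$ if $u=0$ on $\partial B_1$ and $\int_{B_1}u\,\Delta\varphi\,dx=\int_\Gamma g\,\varphi\,dH^{n-1}$ for all $\varphi\in C_c^\infty(B_1)$.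 Then this problem has exactly one distributional solution $u$, and $u$ is not locally Lipschitz in $B_1$. More precisely, with $e_n$ the $n$-th standard basis vector, $u$ is differentiable at $\varepsilon e_n$ for every $\varepsilon\in(0,1/2)$, and $$\lim_{\varepsilon\downarrow 0}\partial_{x_1}u(\varepsilon e_n)=-\infty .$$ -/

import Mathlib

open MeasureTheory Set Filter Topology
open scoped ContDiff

/-- `Γ ⊆ E` is an embedded smooth hypersurface without boundary: near each of its points, after a
rotation of the coordinates, it is the graph of a smooth function. Here `ν` is the unit vector of
the vertical axis, `inner ℝ ν x` is the height of `x`, and `x - inner ℝ ν x • ν` is the projection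
of `x` to the hyperplane orthogonal to `ν` (only the values of `ψ` on that hyperplane matter). -/
def IsSmoothHypersurface {E : Type*} [NormedAddCommGroup E] [InnerProductSpace ℝ E]
    (Γ : Set E) : Prop :=
  ∀ x₀ ∈ Γ, ∃ ν : E, ‖ν‖ = 1 ∧ ∃ r : ℝ, 0 < r ∧ ∃ ψ : E → ℝ, ContDiff ℝ ∞ ψ ∧
    Γ ∩ Metric.ball x₀ r =
      {x ∈ Metric.ball x₀ r | inner ℝ ν x = ψ (x - inner ℝ ν x • ν)}

/-- `Γ` is a smooth closed hypersurface: compact, embedded, without boundary. -/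
def IsSmoothClosedHypersurface {E : Type*} [NormedAddCommGroup E] [InnerProductSpace ℝ E]
    (Γ : Set E) : Prop :=
  IsCompact Γ ∧ IsSmoothHypersurface Γ

/-- `u` is a distributional solution of `Δ u = g dH^{n-1}⌞Γ` in `Ω ⊆ ℝⁿ`, `u = 0` on `∂Ω`:
`u ∈ C(closure Ω)` vanishes on `∂Ω`, and `∫_Ω u Δφ dx = ∫_Γ g φ dH^{n-1}` for all
`φ ∈ C_c^∞(Ω)`. The measure `H^{n-1}` is normalized so as to be Lebesgue measure on hyperplanes.
Only the values of `u` on the closure of `Ω` and those of `g` on `Γ` matter. -/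
def IsDistributionalSolution {n : ℕ} (Ω Γ : Set (EuclideanSpace ℝ (Fin n)))
    (g u : EuclideanSpace ℝ (Fin n) → ℝ) : Prop :=
  ContinuousOn u (closure Ω) ∧
  (∀ x ∈ frontier Ω, u x = 0) ∧
  ∀ φ : EuclideanSpace ℝ (Fin n) → ℝ, ContDiff ℝ ∞ φ → HasCompactSupport φ → tsupport φ ⊆ Ω →
    ∫ x in Ω, u x * Laplacian.laplacian φ x = ∫ x in Γ, g x * φ x ∂μHE[n - 1]

/-- The profile `η(t) = 1 / |log t|` for `t > 0`, `η(t) = 0` for `t ≤ 0`; it is used for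
`-1/2 < t < 1/2` only. -/
noncomputable def logProfile (t : ℝ) : ℝ :=
  if 0 < t then 1 / |Real.log t| else 0

/-! Write n = d + 1, p = n/2 and Φ = `powerPrimitive p`, so that Φ(|x|²) has Laplacian c δ₀ with c >
0. The Green function of the unit ball is, up to the factor c, G(x, y) = Φ(|x - y|²) - Φ(|y|²|x|² -
2 x·y + 1). The second term is the Kelvin reflection written without division, so that y = 0 is
allowed; the two arguments agree when |x| = 1. The solution is u(x) = c⁻¹ ∫_Γ G(x, y) g(y)
dH^{n-1}(y).

Existence. Adding t > 0 to both arguments makes the kernel C². By `laplacian_powerPrimitive_quad`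
the Laplacian of the first term is then a dilated `bubble` of mass c that concentrates at y as t →
0, and that of the second is O(t), because Γ keeps a positive distance from the unit sphere. The
limit t → 0 is uniform in x: a compact smooth hypersurface satisfies H^{n-1}(Γ ∩ B_r(x)) ≤ C
r^{n-1}, and by layer cake the part of the potential from |x - y|² < T is at most 2C√T
(`HasGrowth.lintegral_powerPrimitive_sub_le`). Uniform convergence gives both continuity of u and
the equation (`HasGrowth.integral_greenPotential_mul_laplacian`).

Uniqueness. The difference of two solutions is distributionally harmonic and vanishes on the sphere;
after mollification the classical maximum principle applies
(`nonpos_of_integral_mul_laplacian_eq_zero`).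

Blow-up. At x = ε e_n the singular part of ∂₁G is -2 y₁ |x - y|^{-n}. On the flat piece of Γ this
integrates against η(y₁) to -2 ∫ η(y₁) y₁ (|y|² + ε²)^{-n/2}, while all other contributions stay
bounded. The integrand is nonpositive, sign included, and the dyadic shell |y| ~ 2^{-k} contributes
at least a constant times 1/k in absolute value once ε ≤ 2^{-k}: the factor 1/|log y₁| is of order
1/k and the powers of 2^{-k} cancel. The harmonic series diverges
(`tendsto_setIntegral_logProfile_atTop`). -/

/-! ### The radial profile of the fundamental solution. -/

/-- The primitive `s ↦ ∫₁ˢ τ^(-p) dτ`; for `p = n / 2`, the function `x ↦ powerPrimitive p (‖x‖²)`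
is, up to a positive factor, the fundamental solution of the Laplace operator on `ℝⁿ`. -/
noncomputable def powerPrimitive (p s : ℝ) : ℝ := ∫ τ in (1 : ℝ)..s, τ ^ (-p)

lemma intervalIntegrable_rpow_of_pos (p : ℝ) {a b : ℝ} (ha : 0 < a) (hb : 0 < b) :
    IntervalIntegrable (fun τ : ℝ => τ ^ (-p)) volume a b :=
  intervalIntegral.intervalIntegrable_rpow (Or.inr fun h => by
    have := h.1
    rcases le_total a b with hab | hab <;> simp [hab] at this <;> linarith)

lemma hasDerivAt_powerPrimitive (p : ℝ) {s : ℝ} (hs : 0 < s) :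
    HasDerivAt (powerPrimitive p) (s ^ (-p)) s := by
  refine intervalIntegral.integral_hasDerivAt_right
    (intervalIntegrable_rpow_of_pos p one_pos hs) ?_ ?_
  · exact (Measurable.stronglyMeasurable (by fun_prop)).stronglyMeasurableAtFilter
  · exact Real.continuousAt_rpow_const _ _ (Or.inl hs.ne')

lemma continuousOn_powerPrimitive (p : ℝ) : ContinuousOn (powerPrimitive p) (Ioi 0) :=
  fun _ hs => (hasDerivAt_powerPrimitive p hs).continuousAt.continuousWithinAt

lemma contDiffAt_powerPrimitive (p : ℝ) {s : ℝ} (hs : 0 < s) :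
    ContDiffAt ℝ 2 (powerPrimitive p) s := by
  have h : ContDiffOn ℝ (1 + 1) (powerPrimitive p) (Ioi 0) := by
    rw [contDiffOn_succ_iff_deriv_of_isOpen isOpen_Ioi]
    refine ⟨fun x hx => (hasDerivAt_powerPrimitive p hx).differentiableAt.differentiableWithinAt,
      by simp, ?_⟩
    refine ContDiffOn.congr (f := fun x : ℝ => x ^ (-p)) ?_
      fun x hx => (hasDerivAt_powerPrimitive p hx).deriv
    exact fun x hx => (Real.contDiffAt_rpow_const_of_ne (ne_of_gt hx)).contDiffWithinAt
  have := h.contDiffAt (Ioi_mem_nhds hs)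
  norm_num at this
  exact this

lemma powerPrimitive_sub (p : ℝ) {a b : ℝ} (ha : 0 < a) (hb : 0 < b) :
    powerPrimitive p b - powerPrimitive p a = ∫ τ in a..b, τ ^ (-p) :=
  intervalIntegral.integral_interval_sub_left (intervalIntegrable_rpow_of_pos p one_pos hb)
    (intervalIntegrable_rpow_of_pos p one_pos ha)

lemma powerPrimitive_mono (p : ℝ) {a b : ℝ} (ha : 0 < a) (hab : a ≤ b) :
    powerPrimitive p a ≤ powerPrimitive p b := by
  have := powerPrimitive_sub p ha (ha.trans_le hab)
  have h2 : 0 ≤ ∫ τ in a..b, τ ^ (-p) :=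
    intervalIntegral.integral_nonneg hab fun u hu => Real.rpow_nonneg (ha.le.trans hu.1) _
  linarith

lemma powerPrimitive_sub_le {p : ℝ} (hp : 0 ≤ p) {a b : ℝ} (ha : 0 < a) (hab : a ≤ b) :
    powerPrimitive p b - powerPrimitive p a ≤ a ^ (-p) * (b - a) := by
  rw [powerPrimitive_sub p ha (ha.trans_le hab)]
  have h := intervalIntegral.integral_mono_on hab
    (intervalIntegrable_rpow_of_pos p ha (ha.trans_le hab))
    (intervalIntegrable_const (c := a ^ (-p)))
    fun x hx => Real.rpow_le_rpow_of_nonpos ha hx.1 (by linarith)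
  simpa [mul_comm] using h

lemma ofReal_powerPrimitive_sub (p : ℝ) {a b : ℝ} (ha : 0 < a) (hab : a ≤ b) :
    ENNReal.ofReal (powerPrimitive p b - powerPrimitive p a)
      = ∫⁻ τ in Ioc a b, ENNReal.ofReal (τ ^ (-p)) := by
  rw [powerPrimitive_sub p ha (ha.trans_le hab), intervalIntegral.integral_of_le hab]
  refine ofReal_integral_eq_lintegral_ofReal
    (intervalIntegrable_rpow_of_pos p ha (ha.trans_le hab)).1 ?_
  filter_upwards [ae_restrict_mem measurableSet_Ioc] with x hx
  exact Real.rpow_nonneg (ha.le.trans hx.1.le) _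

/-! ### Laplacians of radial profiles and Green's identity. -/

section Laplacian

variable {E : Type*} [NormedAddCommGroup E] [InnerProductSpace ℝ E]

lemma laplacian_eq_sum_fderiv [FiniteDimensional ℝ E] {ι : Type*} [Fintype ι] (b : OrthonormalBasis ι ℝ E) {f : E → ℝ}
    (hf : ContDiff ℝ 2 f) (x : E) :
    Laplacian.laplacian f x = ∑ i, fderiv ℝ (fun z => fderiv ℝ f z (b i)) x (b i) := by
  rw [InnerProductSpace.laplacian_eq_iteratedFDeriv_orthonormalBasis f b]
  refine Finset.sum_congr rfl fun i _ => ?_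
  rw [iteratedFDeriv_two_apply]
  have hd : DifferentiableAt ℝ (fderiv ℝ f) x :=
    (hf.fderiv_right (m := 1) (by norm_num)).differentiable (by norm_num) x
  rw [fderiv_clm_apply hd (differentiableAt_const _)]
  simp

lemma contDiff_fderiv_apply_const {m : WithTop ℕ∞} {f : E → ℝ} (hf : ContDiff ℝ (m + 1) f)
    (v : E) : ContDiff ℝ m (fun z => fderiv ℝ f z v) :=
  (hf.fderiv_right le_rfl).clm_apply contDiff_const

lemma continuous_laplacian [FiniteDimensional ℝ E] {f : E → ℝ} (hf : ContDiff ℝ 2 f) :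
    Continuous (Laplacian.laplacian f) := by
  rw [funext (laplacian_eq_sum_fderiv (stdOrthonormalBasis ℝ E) hf)]
  refine continuous_finsetSum _ fun i _ => ?_
  exact (contDiff_fderiv_apply_const (m := 0)
    (contDiff_fderiv_apply_const (m := 1) (by norm_num; exact hf) _) _).continuous

lemma tsupport_laplacian_subset [FiniteDimensional ℝ E] {f : E → ℝ} (hf : ContDiff ℝ 2 f) :
    tsupport (Laplacian.laplacian f) ⊆ tsupport f := by
  refine closure_minimal (fun x hx => ?_) (isClosed_tsupport f)
  by_contra h
  refine hx ?_
  rw [laplacian_eq_sum_fderiv (stdOrthonormalBasis ℝ E) hf]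
  refine Finset.sum_eq_zero fun i _ => ?_
  have : x ∉ tsupport (fun z => fderiv ℝ (fun z => fderiv ℝ f z (stdOrthonormalBasis ℝ E i)) z
      (stdOrthonormalBasis ℝ E i)) := fun h' =>
    h (tsupport_fderiv_apply_subset ℝ _ (tsupport_fderiv_apply_subset ℝ _ h'))
  exact image_eq_zero_of_notMem_tsupport (f := fun z => fderiv ℝ (fun z => fderiv ℝ f z
    (stdOrthonormalBasis ℝ E i)) z (stdOrthonormalBasis ℝ E i)) this

/-- The quadratic polynomials `a ‖x‖² - 2 ⟪y, x⟫ + b`. -/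
noncomputable def quad (a b : ℝ) (y x : E) : ℝ := a * ‖x‖ ^ 2 - 2 * inner ℝ y x + b

lemma contDiff_quad {m : WithTop ℕ∞} (a b : ℝ) (y : E) : ContDiff ℝ m (quad a b y) :=
  ((contDiff_const.mul (contDiff_norm_sq ℝ)).sub
    (contDiff_const.mul (contDiff_const.inner ℝ contDiff_id))).add contDiff_const

lemma hasFDerivAt_quad (a b : ℝ) (y x : E) :
    HasFDerivAt (quad a b y) ((2 : ℝ) • innerSL ℝ (a • x - y)) x := by
  have h := (((hasFDerivAt_id x).norm_sq.const_mul a).sub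
    ((innerSL ℝ y).hasFDerivAt.const_mul (2 : ℝ))).add_const b
  refine h.congr_fderiv ?_
  ext v
  simp
  ring

/-- The condition on a, b, y says that the discriminant vanishes, so the square can be completed.
Multiplying by a instead of dividing keeps the case a = 0, which occurs for the Kelvin term at y =
0. -/
lemma mul_quad {a b : ℝ} {y : E} (hab : ‖y‖ ^ 2 = a * b) (x : E) :
    a * quad a b y x = ‖a • x - y‖ ^ 2 := by
  rw [norm_sub_sq_real, norm_smul, mul_pow, hab, inner_smul_left, real_inner_comm]
  simp [quad]
  ring

lemma quad_one_normSq (y x : E) : quad 1 (‖y‖ ^ 2) y x = ‖x - y‖ ^ 2 := by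
  rw [norm_sub_sq_real, quad, real_inner_comm]; ring

lemma hasFDerivAt_powerPrimitive_quad (p : ℝ) {a b t : ℝ} {y x : E} (h : 0 < quad a b y x + t) :
    HasFDerivAt (fun z => powerPrimitive p (quad a b y z + t))
      ((2 * (quad a b y x + t) ^ (-p)) • innerSL ℝ (a • x - y)) x := by
  have := (hasDerivAt_powerPrimitive p h).comp_hasFDerivAt x
    ((hasFDerivAt_quad a b y x).add_const t)
  refine this.congr_fderiv ?_
  rw [smul_smul, mul_comm]

lemma contDiff_powerPrimitive_quad (p : ℝ) {a b t : ℝ} {y : E} (h : ∀ x, 0 < quad a b y x + t) :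
    ContDiff ℝ 2 (fun z => powerPrimitive p (quad a b y z + t)) :=
  contDiff_iff_contDiffAt.2 fun x => (contDiffAt_powerPrimitive p (h x)).comp x
    ((contDiff_quad a b y).add contDiff_const).contDiffAt

/-- For the polynomial q one has |∇q|² = 4aq and Δq = 2na, so Φ''(q + t)|∇q|² + Φ'(q + t)Δq = (q +
t)^(-p-1) (-4paq + 2na(q + t)). With p = n/2 the terms in q cancel and only the multiple of t
remains. One formula serves both terms of the Green kernel. -/
lemma laplacian_powerPrimitive_quad [FiniteDimensional ℝ E] {a b t : ℝ} {y : E}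
    (hab : ‖y‖ ^ 2 = a * b) (h : ∀ x, 0 < quad a b y x + t) (x : E) :
    Laplacian.laplacian
        (fun z => powerPrimitive (Module.finrank ℝ E / 2 : ℝ) (quad a b y z + t)) x
      = 2 * Module.finrank ℝ E * a * t *
        (quad a b y x + t) ^ (-(Module.finrank ℝ E / 2 : ℝ) - 1) := by
  set p : ℝ := Module.finrank ℝ E / 2 with hp
  have e := stdOrthonormalBasis ℝ E
  rw [laplacian_eq_sum_fderiv e (contDiff_powerPrimitive_quad p h)]
  have hterm : ∀ v : E, ‖v‖ = 1 → fderiv ℝ (fun z => fderiv ℝ (fun z => powerPrimitive p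
      (quad a b y z + t)) z v) x v = -4 * p * (quad a b y x + t) ^ (-p - 1)
        * (inner ℝ v (a • x - y)) ^ 2 + 2 * a * (quad a b y x + t) ^ (-p) := by
    intro v hv
    have h1 : (fun z => fderiv ℝ (fun z => powerPrimitive p (quad a b y z + t)) z v)
        = fun z => (quad a b y z + t) ^ (-p) * (2 * (a * inner ℝ v z - inner ℝ v y)) := by
      funext z
      rw [(hasFDerivAt_powerPrimitive_quad p (h z)).fderiv]
      simp [real_inner_comm]
      ring
    rw [h1]
    have h2 : HasFDerivAt (fun z => (quad a b y z + t) ^ (-p))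
        ((-p * (quad a b y x + t) ^ (-p - 1)) • ((2 : ℝ) • innerSL ℝ (a • x - y))) x :=
      ((hasFDerivAt_quad a b y x).add_const t).rpow_const (Or.inl (h x).ne')
    have h3 : HasFDerivAt (fun z => 2 * (a * inner ℝ v z - inner ℝ v y))
        ((2 : ℝ) • (a • innerSL ℝ v)) x :=
      (((innerSL ℝ v).hasFDerivAt.const_mul a).sub_const _).const_mul 2
    rw [(h2.fun_mul h3).fderiv]
    simp [inner_sub_right, inner_smul_right, hv,
      real_inner_comm]
    ring
  rw [Finset.sum_congr rfl fun i _ => hterm (e i) (e.orthonormal.1 i), Finset.sum_add_distrib,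
    ← Finset.mul_sum]
  have hs : ∑ i, (inner ℝ (e i) (a • x - y)) ^ 2 = a * quad a b y x := by
    rw [mul_quad hab, ← e.sum_sq_norm_inner_right]
    simp
  rw [hs]
  have hr : (quad a b y x + t) ^ (-p) = (quad a b y x + t) ^ (-p - 1) * (quad a b y x + t) := by
    rw [← Real.rpow_add_one (h x).ne']; ring_nf
  have hn : (Module.finrank ℝ E : ℝ) = 2 * p := by rw [hp]; ring
  simp only [Finset.sum_const, Finset.card_univ, Fintype.card_fin, nsmul_eq_mul]
  rw [hr, hn]
  ring

variable [FiniteDimensional ℝ E] [MeasurableSpace E] [BorelSpace E]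

lemma integral_mul_fderiv_fderiv {μ : Measure E} [μ.IsAddHaarMeasure] {F φ : E → ℝ}
    (hF : ContDiff ℝ 2 F) (hφ : ContDiff ℝ 2 φ) (hc : HasCompactSupport φ) (v : E) :
    ∫ x, F x * fderiv ℝ (fun z => fderiv ℝ φ z v) x v ∂μ
      = ∫ x, fderiv ℝ (fun z => fderiv ℝ F z v) x v * φ x ∂μ := by
  have hF1 := contDiff_fderiv_apply_const (m := 1) (by norm_num; exact hF) v
  have hφ1 := contDiff_fderiv_apply_const (m := 1) (by norm_num; exact hφ) v
  have hF2 := contDiff_fderiv_apply_const (m := 0) (by norm_num; exact hF1) v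
  have hφ2 := contDiff_fderiv_apply_const (m := 0) (by norm_num; exact hφ1) v
  have hcomp : ∀ g : E → ℝ, tsupport g ⊆ tsupport φ → HasCompactSupport g := fun g hg =>
    hc.of_isClosed_subset (isClosed_tsupport g) hg
  have hc1 := hcomp _ (tsupport_fderiv_apply_subset ℝ v)
  have hc2 := hcomp _ ((tsupport_fderiv_apply_subset ℝ v).trans (tsupport_fderiv_apply_subset ℝ v))
  have key : ∀ f g : E → ℝ, Continuous f → Continuous g → HasCompactSupport g →
      Integrable (fun x => f x * g x) μ := fun f g hf hg h =>
    (hf.mul hg).integrable_of_hasCompactSupport h.mul_left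
  rw [integral_mul_fderiv_eq_neg_fderiv_mul_of_integrable
    (key _ _ hF1.continuous hφ1.continuous hc1)
    (key _ _ hF.continuous hφ2.continuous hc2) (key _ _ hF.continuous hφ1.continuous hc1)
    (fun x _ => hF.differentiable (by norm_num) x)
    (fun x _ => hφ1.differentiable (by norm_num) x),
    integral_mul_fderiv_eq_neg_fderiv_mul_of_integrable
    (key _ _ hF2.continuous hφ.continuous hc)
    (key _ _ hF1.continuous hφ1.continuous hc1) (key _ _ hF1.continuous hφ.continuous hc)
    (fun x _ => hF1.differentiable (by norm_num) x)
    (fun x _ => hφ.differentiable (by norm_num) x), neg_neg]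

/-- Green's second identity for a test function. -/
lemma integral_mul_laplacian {μ : Measure E} [μ.IsAddHaarMeasure] {F φ : E → ℝ}
    (hF : ContDiff ℝ 2 F) (hφ : ContDiff ℝ 2 φ) (hc : HasCompactSupport φ) :
    ∫ x, F x * Laplacian.laplacian φ x ∂μ = ∫ x, Laplacian.laplacian F x * φ x ∂μ := by
  have b := stdOrthonormalBasis ℝ E
  simp_rw [laplacian_eq_sum_fderiv b hF, laplacian_eq_sum_fderiv b hφ, Finset.mul_sum,
    Finset.sum_mul]
  have h2 : ∀ {g : E → ℝ}, ContDiff ℝ 2 g → ∀ v : E,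
      Continuous (fun x => fderiv ℝ (fun z => fderiv ℝ g z v) x v) := fun hg v =>
    (contDiff_fderiv_apply_const (m := 0)
    (contDiff_fderiv_apply_const (m := 1) (by norm_num; exact hg) _) _).continuous
  rw [integral_finsetSum, integral_finsetSum]
  · exact Finset.sum_congr rfl fun i _ => integral_mul_fderiv_fderiv hF hφ hc _
  · exact fun i _ => ((h2 hF _).mul hφ.continuous).integrable_of_hasCompactSupport hc.mul_left
  · refine fun i _ => (hF.continuous.mul (h2 hφ _)).integrable_of_hasCompactSupport
      (HasCompactSupport.mul_left ?_)
    exact hc.of_isClosed_subset (isClosed_tsupport _)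
      ((tsupport_fderiv_apply_subset ℝ _).trans (tsupport_fderiv_apply_subset ℝ _))

end Laplacian

/-! ### Area growth of smooth hypersurfaces. -/

section Hypersurface

lemma LipschitzOnWith.euclideanHausdorffMeasure_image_le {X Y : Type*} [EMetricSpace X]
    [EMetricSpace Y] [MeasurableSpace X] [BorelSpace X] [MeasurableSpace Y] [BorelSpace Y]
    {K : NNReal} {f : X → Y} {s : Set X} (h : LipschitzOnWith K f s) (d : ℕ) :
    μHE[d] (f '' s) ≤ (K : ENNReal) ^ d * μHE[d] s := by
  have := h.hausdorffMeasure_image_le (d := d) (by positivity)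
  simp only [Measure.euclideanHausdorffMeasure_def, Measure.smul_apply, ENNReal.smul_def,
    smul_eq_mul]
  rw [ENNReal.rpow_natCast] at this
  calc _ ≤ _ := mul_le_mul_right this _
    _ = _ := by ring

variable {E : Type*} [NormedAddCommGroup E] [InnerProductSpace ℝ E] [FiniteDimensional ℝ E]
  [MeasurableSpace E] [BorelSpace E]

/-- Inside H the set is a metric ball, and the normalized Hausdorff measure of H is a Haar measure,
which scales. -/
lemma euclideanHausdorffMeasure_submodule_inter_ball_le (H : Submodule ℝ E) {z : E} (hz : z ∈ H)
    {r : ℝ} (hr : 0 < r) :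
    μHE[Module.finrank ℝ H] ((H : Set E) ∩ Metric.ball z r)
      ≤ ENNReal.ofReal (r ^ Module.finrank ℝ H) *
        μHE[Module.finrank ℝ H] (Metric.ball (0 : H) 1) := by
  have h : (H : Set E) ∩ Metric.ball z r = H.subtypeₗᵢ '' Metric.ball (⟨z, hz⟩ : H) r := by
    ext x
    simp only [mem_inter_iff, SetLike.mem_coe, mem_image, Metric.mem_ball]
    exact ⟨fun hx => ⟨⟨x, hx.1⟩, hx.2, rfl⟩, by rintro ⟨w, hw, rfl⟩; exact ⟨w.2, hw⟩⟩
  rw [h, H.subtypeₗᵢ.isometry.euclideanHausdorffMeasure_image, Measure.addHaar_ball_of_pos _ _ hr]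

/-- Near each of its points, a smooth hypersurface has at most Euclidean area growth. -/
lemma IsSmoothHypersurface.exists_local_growth {d : ℕ} (hd : Module.finrank ℝ E = d + 1)
    {Γ : Set E} (hΓ : IsSmoothHypersurface Γ) {x₀ : E} (hx₀ : x₀ ∈ Γ) :
    ∃ ρ > 0, ∃ C : ENNReal, C ≠ ⊤ ∧ ∀ x : E, ∀ r : ℝ, 0 < r →
      μHE[d] (Γ ∩ Metric.ball x₀ ρ ∩ Metric.ball x r) ≤ C * ENNReal.ofReal (r ^ d) := by
  obtain ⟨ν, hν, r₀, hr₀, ψ, hψ, hgraph⟩ := hΓ x₀ hx₀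
  have hν0 : ν ≠ 0 := by rintro rfl; simp at hν
  have : Fact (Module.finrank ℝ E = d + 1) := ⟨hd⟩
  have hH : Module.finrank ℝ (ℝ ∙ ν)ᗮ = d := Submodule.finrank_orthogonal_span_singleton hν0
  set H : Submodule ℝ E := (ℝ ∙ ν)ᗮ with hHdef
  set π : E → E := fun x => x - inner ℝ ν x • ν with hπ
  have hπH : ∀ x, π x ∈ H := fun x => by
    rw [hHdef, Submodule.mem_orthogonal_singleton_iff_inner_right]
    simp [hπ, inner_sub_right, inner_smul_right, hν]
  have hπdist : ∀ x y, dist (π x) (π y) ≤ dist x y := fun x y => by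
    rw [dist_eq_norm, dist_eq_norm]
    have h1 : π x - π y = (x - y) - inner ℝ ν (x - y) • ν := by
      simp only [hπ, inner_sub_right, sub_smul]; abel
    have h2 : ‖π x - π y‖ ^ 2 ≤ ‖x - y‖ ^ 2 := by
      rw [h1, norm_sub_sq_real, inner_smul_right, norm_smul, hν, real_inner_comm]
      simp only [mul_one, Real.norm_eq_abs, sq_abs]
      nlinarith [sq_nonneg (inner ℝ (x - y) ν)]
    exact le_of_sq_le_sq h2 (norm_nonneg _)
  set P : E → E := fun z => z + ψ z • ν with hP
  have hPs : ContDiff ℝ ∞ P := contDiff_id.add (hψ.smul contDiff_const)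
  obtain ⟨K, t, ht, hK⟩ :=
    ((hPs.of_le (by exact_mod_cast le_top)).contDiffAt (x := π x₀)).exists_lipschitzOnWith
  obtain ⟨ρ, hρ, hρt⟩ := Metric.mem_nhds_iff.1 ht
  refine ⟨min ρ r₀, lt_min hρ hr₀, (K : ENNReal) ^ d * μHE[d] (Metric.ball (0 : H) 1), ?_, ?_⟩
  · refine ENNReal.mul_ne_top (by simp) ?_
    have : μHE[Module.finrank ℝ H] (Metric.ball (0 : H) 1) < ⊤ := measure_ball_lt_top
    rw [← hH]; exact this.ne
  · intro x r hr
    -- The projection π is 1-Lipschitz, so the points of Γ within r of x lie over a flat disc of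
    -- radius r; the graph map P, Lipschitz near π x₀, carries that disc back. The constant does not
    -- depend on x or r.
    have hsub : Γ ∩ Metric.ball x₀ (min ρ r₀) ∩ Metric.ball x r
        ⊆ P '' ((H : Set E) ∩ Metric.ball (π x₀) ρ ∩ Metric.ball (π x) r) := by
      rintro y ⟨⟨hyΓ, hy0⟩, hyx⟩
      have hy' : y ∈ Γ ∩ Metric.ball x₀ r₀ :=
        ⟨hyΓ, Metric.ball_subset_ball (min_le_right _ _) hy0⟩
      rw [hgraph] at hy'
      refine ⟨π y, ⟨⟨hπH y, ?_⟩, ?_⟩, ?_⟩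
      · exact (hπdist _ _).trans_lt (hy0.trans_le (min_le_left _ _))
      · exact (hπdist _ _).trans_lt hyx
      · simp only [hP]
        rw [show ψ (π y) = inner ℝ ν y from hy'.2.symm]
        simp [hπ]
    calc _ ≤ _ := measure_mono hsub
      _ ≤ (K : ENNReal) ^ d *
          μHE[d] ((H : Set E) ∩ Metric.ball (π x₀) ρ ∩ Metric.ball (π x) r) :=
        (hK.mono fun z hz => hρt hz.1.2).euclideanHausdorffMeasure_image_le d
      _ ≤ (K : ENNReal) ^ d * μHE[d] ((H : Set E) ∩ Metric.ball (π x) r) := by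
        gcongr; exact inter_subset_left
      _ ≤ (K : ENNReal) ^ d * (ENNReal.ofReal (r ^ d) * μHE[d] (Metric.ball (0 : H) 1)) := by
        gcongr
        have := euclideanHausdorffMeasure_submodule_inter_ball_le H (hπH x) hr
        rwa [hH] at this
      _ = _ := by ring

/-- A compact smooth hypersurface has at most Euclidean area growth. -/
lemma IsSmoothClosedHypersurface.exists_growth {d : ℕ} (hd : Module.finrank ℝ E = d + 1)
    {Γ : Set E} (hΓ : IsSmoothClosedHypersurface Γ) :
    ∃ C : ENNReal, C ≠ ⊤ ∧ ∀ x : E, ∀ r : ℝ, 0 < r →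
      μHE[d].restrict Γ (Metric.ball x r) ≤ C * ENNReal.ofReal (r ^ d) := by
  choose! ρ hρ C hC hCr using fun x₀ (h : x₀ ∈ Γ) => hΓ.2.exists_local_growth hd h
  obtain ⟨T, hTΓ, hcov⟩ := hΓ.1.elim_nhds_subcover (fun x => Metric.ball x (ρ x))
    fun x hx => Metric.ball_mem_nhds x (hρ x hx)
  refine ⟨∑ p ∈ T, C p, by simpa using fun p hp => hC p (hTΓ p hp), fun x r hr => ?_⟩
  rw [Measure.restrict_apply Metric.isOpen_ball.measurableSet, Finset.sum_mul]
  have hsub : Metric.ball x r ∩ Γ ⊆ ⋃ p ∈ T, Γ ∩ Metric.ball p (ρ p) ∩ Metric.ball x r := by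
    rintro y ⟨hyx, hyΓ⟩
    obtain ⟨p, hp, hyp⟩ := mem_iUnion₂.1 (hcov hyΓ)
    exact mem_iUnion₂.2 ⟨p, hp, ⟨hyΓ, hyp⟩, hyx⟩
  calc _ ≤ _ := measure_mono hsub
    _ ≤ _ := measure_biUnion_finset_le _ _
    _ ≤ _ := Finset.sum_le_sum fun p hp => hCr p (hTΓ p hp) x r hr

end Hypersurface

/-! ### The maximum principle for distributionally harmonic functions. -/

section MaximumPrinciple

open scoped Convolution

/-- Were the second derivative positive, x would also be a local minimum, so g would be constant
near x and its second derivative zero. -/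
lemma deriv_deriv_nonpos_of_isLocalMax {g : ℝ → ℝ} {x : ℝ} (hg : ContinuousAt g x)
    (hmax : IsLocalMax g x) : deriv (deriv g) x ≤ 0 := by
  by_contra! h
  have hmin := isLocalMin_of_deriv_deriv_pos h hmax.deriv_eq_zero hg
  have hconst : g =ᶠ[𝓝 x] fun _ => g x := by
    filter_upwards [hmax, hmin] with y h1 h2 using le_antisymm h1 h2
  have h1 : deriv g =ᶠ[𝓝 x] deriv fun _ => g x := hconst.deriv
  rw [h1.deriv_eq] at h
  simp at h

variable {E : Type*} [NormedAddCommGroup E] [InnerProductSpace ℝ E]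

lemma fderiv_fderiv_nonpos_of_isLocalMax {F : E → ℝ} (hF : ContDiff ℝ 2 F) {x : E}
    (hmax : IsLocalMax F x) (v : E) : fderiv ℝ (fun z => fderiv ℝ F z v) x v ≤ 0 := by
  have hline : ∀ s : ℝ, HasDerivAt (fun s : ℝ => x + s • v) v s := fun s => by
    simpa using ((hasDerivAt_id s).smul_const v).const_add x
  have hd : ∀ {G : E → ℝ}, Differentiable ℝ G → ∀ s : ℝ,
      deriv (fun s : ℝ => G (x + s • v)) s = fderiv ℝ G (x + s • v) v := fun hG s =>
    ((hG _).hasFDerivAt.comp_hasDerivAt s (hline s)).deriv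
  have h1 : deriv (fun s : ℝ => F (x + s • v)) = fun s => fderiv ℝ F (x + s • v) v :=
    funext (hd (hF.differentiable (by norm_num)))
  have h2 := hd (G := fun z => fderiv ℝ F z v)
    ((contDiff_fderiv_apply_const (m := 1) (by norm_num; exact hF) v).differentiable
      (by norm_num)) 0
  have hcont : Continuous (fun s : ℝ => x + s • v) := by fun_prop
  have h3 := deriv_deriv_nonpos_of_isLocalMax (g := fun s : ℝ => F (x + s • v)) (x := 0)
    (hF.continuous.comp hcont).continuousAt
    (by
      have hx : x = x + (0 : ℝ) • v := by simp
      rw [hx] at hmax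
      exact hmax.comp_continuous (b := (0 : ℝ)) (g := fun s : ℝ => x + s • v)
        hcont.continuousAt)
  rw [h1, h2] at h3
  simpa using h3

lemma laplacian_nonpos_of_isLocalMax [FiniteDimensional ℝ E] {F : E → ℝ} (hF : ContDiff ℝ 2 F)
    {x : E} (hmax : IsLocalMax F x) : Laplacian.laplacian F x ≤ 0 := by
  rw [laplacian_eq_sum_fderiv (stdOrthonormalBasis ℝ E) hF]
  exact Finset.sum_nonpos fun i _ => fderiv_fderiv_nonpos_of_isLocalMax hF hmax _

lemma laplacian_norm_sq [FiniteDimensional ℝ E] (x : E) :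
    Laplacian.laplacian (fun z : E => ‖z‖ ^ 2) x = 2 * Module.finrank ℝ E := by
  rw [laplacian_eq_sum_fderiv (stdOrthonormalBasis ℝ E) (contDiff_norm_sq ℝ)]
  have h : ∀ v : E, ‖v‖ = 1 →
      fderiv ℝ (fun z => fderiv ℝ (fun z : E => ‖z‖ ^ 2) z v) x v = 2 := fun v hv => by
    have h1 : (fun z => fderiv ℝ (fun z : E => ‖z‖ ^ 2) z v) = fun z => 2 * inner ℝ v z := by
      funext z
      simp [real_inner_comm]
    have h2 : HasFDerivAt (fun z => 2 * inner ℝ v z) ((2 : ℝ) • innerSL ℝ v) x :=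
      (innerSL ℝ v).hasFDerivAt.const_mul (2 : ℝ)
    rw [h1, h2.fderiv]
    simp [hv]
  rw [Finset.sum_congr rfl fun i _ => h _ ((stdOrthonormalBasis ℝ E).orthonormal.1 i)]
  simp [mul_comm]

lemma laplacian_comp_const_sub [FiniteDimensional ℝ E] {f : E → ℝ} (hf : ContDiff ℝ 2 f)
    (a x : E) : Laplacian.laplacian (fun y => f (a - y)) x = Laplacian.laplacian f (a - x) := by
  have hs : ContDiff ℝ 2 (fun y : E => a - y) := contDiff_const.sub contDiff_id
  rw [laplacian_eq_sum_fderiv (stdOrthonormalBasis ℝ E) (f := fun y => f (a - y))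
      (hf.comp hs), laplacian_eq_sum_fderiv (stdOrthonormalBasis ℝ E) hf]
  have key : ∀ g : E → ℝ, Differentiable ℝ g → ∀ y v,
      fderiv ℝ (fun y => g (a - y)) y v = - fderiv ℝ g (a - y) v := fun g hg y v => by
    have : HasFDerivAt (fun y => g (a - y)) (fderiv ℝ g (a - y) ∘L (-.id ℝ E)) y :=
      (hg (a - y)).hasFDerivAt.comp y ((hasFDerivAt_id y).const_sub a)
    rw [this.fderiv]
    simp
  refine Finset.sum_congr rfl fun i _ => ?_
  rw [funext fun y => key f (hf.differentiable (by norm_num)) y _]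
  have h2 := contDiff_fderiv_apply_const (m := 1) (by norm_num; exact hf)
    (stdOrthonormalBasis ℝ E i)
  have := key (fun z => fderiv ℝ f z (stdOrthonormalBasis ℝ E i))
    (h2.differentiable (by norm_num)) x (stdOrthonormalBasis ℝ E i)
  have h3 := fderiv_fun_neg (𝕜 := ℝ) (x := x)
    (f := fun y => fderiv ℝ f (a - y) (stdOrthonormalBasis ℝ E i))
  rw [h3, neg_apply, this, neg_neg]

variable [FiniteDimensional ℝ E] [MeasurableSpace E] [BorelSpace E]

/-- Both derivatives fall on the mollifier, so W need only be locally integrable, and the Laplacian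
becomes a pairing of W with a test function. -/
lemma laplacian_convolution {μ : Measure E} [μ.IsAddHaarMeasure] {W ρ : E → ℝ}
    (hW : LocallyIntegrable W μ) (hρ : ContDiff ℝ 2 ρ) (hc : HasCompactSupport ρ) (x : E) :
    Laplacian.laplacian (W ⋆[ContinuousLinearMap.lsmul ℝ ℝ, μ] ρ) x
      = ∫ y, W y * Laplacian.laplacian ρ (x - y) ∂μ := by
  have hC : ContDiff ℝ 2 (W ⋆[ContinuousLinearMap.lsmul ℝ ℝ, μ] ρ) :=
    hc.contDiff_convolution_right _ hW hρ
  have key : ∀ {g : E → ℝ}, ContDiff ℝ 1 g → HasCompactSupport g → ∀ y v,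
      fderiv ℝ (W ⋆[ContinuousLinearMap.lsmul ℝ ℝ, μ] g) y v
        = (W ⋆[ContinuousLinearMap.lsmul ℝ ℝ, μ] fun z => fderiv ℝ g z v) y := by
    intro g hg hgc y v
    rw [(hgc.hasFDerivAt_convolution_right _ hW hg y).fderiv]
    exact convolution_precompR_apply (ContinuousLinearMap.lsmul ℝ ℝ) hW (hgc.fderiv (𝕜 := ℝ))
      (hg.continuous_fderiv (by norm_num)) y v
  have h1 : ∀ v, ContDiff ℝ 1 (fun z => fderiv ℝ ρ z v) := fun v =>
    contDiff_fderiv_apply_const (m := 1) (by norm_num; exact hρ) v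
  have hc1 : ∀ v, HasCompactSupport (fun z => fderiv ℝ ρ z v) := fun v =>
    hc.of_isClosed_subset (isClosed_tsupport _) (tsupport_fderiv_apply_subset ℝ v)
  have hc2 : ∀ v, HasCompactSupport (fun z => fderiv ℝ (fun z => fderiv ℝ ρ z v) z v) := fun v =>
    (hc1 v).of_isClosed_subset (isClosed_tsupport _) (tsupport_fderiv_apply_subset ℝ v)
  rw [laplacian_eq_sum_fderiv (stdOrthonormalBasis ℝ E) hC]
  simp_rw [laplacian_eq_sum_fderiv (stdOrthonormalBasis ℝ E) hρ, Finset.mul_sum]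
  rw [integral_finsetSum]
  · refine Finset.sum_congr rfl fun i _ => ?_
    rw [funext fun y => key (hρ.of_le (by norm_num)) hc y _, key (h1 _) (hc1 _)]
    rfl
  · intro i _
    exact ((hc2 _).convolutionExists_right (ContinuousLinearMap.lsmul ℝ ℝ) hW
      (contDiff_fderiv_apply_const (m := 0) (by norm_num; exact h1 _) _).continuous x)

/-- Weak maximum principle for distributionally harmonic functions vanishing on the boundary. -/
lemma nonpos_of_integral_mul_laplacian_eq_zero {μ : Measure E} [μ.IsAddHaarMeasure]
    [Nontrivial E] {Ω : Set E} (hΩ : IsOpen Ω) (hb : Bornology.IsBounded Ω)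
    {w : E → ℝ} (hw : ContinuousOn w (closure Ω)) (h0 : ∀ x ∈ frontier Ω, w x = 0)
    (hharm : ∀ φ : E → ℝ, ContDiff ℝ ∞ φ → HasCompactSupport φ → tsupport φ ⊆ Ω →
      ∫ x in Ω, w x * Laplacian.laplacian φ x ∂μ = 0) {x : E} (hx : x ∈ Ω) : w x ≤ 0 := by
  by_contra! hpos
  set M := w x with hM
  set W : E → ℝ := indicator Ω w with hWdef
  -- Vanishing on the frontier makes the extension by zero continuous on the whole space; having
  -- compact support, it is uniformly continuous.
  have hWc : Continuous W := continuous_indicator h0 hw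
  have hWcs : HasCompactSupport W :=
    HasCompactSupport.intro (hb.isCompact_closure) fun y hy =>
      indicator_of_notMem (fun h => hy (subset_closure h)) _
  have hWx : W x = M := indicator_of_mem hx _
  obtain ⟨δ, hδ, hunif⟩ := Metric.uniformContinuous_iff.1
    (hWcs.uniformContinuous_of_continuous hWc) (M / 8) (by positivity)
  let ρ : ContDiffBump (0 : E) := ⟨δ / 4, δ / 2, by positivity, by linarith⟩
  set ρn : E → ℝ := ρ.normed μ with hρn
  have hρs : ∀ {m : ℕ∞}, ContDiff ℝ m ρn := ρ.contDiff_normed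
  have hρc : HasCompactSupport ρn := ρ.hasCompactSupport_normed
  set V : E → ℝ := W ⋆[ContinuousLinearMap.lsmul ℝ ℝ, μ] ρn with hV
  have hVW : ∀ y, |V y - W y| ≤ M / 8 := fun y => by
    have h := ρ.dist_normed_convolution_le (μ := μ) (g := W) (x₀ := y) (ε := M / 8)
      hWc.aestronglyMeasurable fun z hz => (hunif (lt_trans hz (by simp [ρ]; linarith))).le
    have h' : (ρ.normed μ ⋆[ContinuousLinearMap.lsmul ℝ ℝ, μ] W) y = V y := by
      rw [convolution_lsmul_swap]
      simp only [hV, convolution, ContinuousLinearMap.lsmul_apply, smul_eq_mul, mul_comm, hρn]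
    rwa [h', Real.dist_eq] at h
  have hVs : ContDiff ℝ 2 V := hρc.contDiff_convolution_right _ hWc.locallyIntegrable
    (hρs (m := 2))
  obtain ⟨R, hR⟩ := hb.subset_closedBall (0 : E)
  have hRx : ‖x‖ ≤ R := by simpa using hR hx
  have hR0 : 0 ≤ R := (norm_nonneg x).trans hRx
  -- A strictly subharmonic perturbation that changes V by at most M/8 on Ω; the summand 1 guards
  -- against R = 0.
  set ε : ℝ := M / (8 * (R ^ 2 + 1)) with hε
  have hε0 : 0 < ε := by positivity
  have hεR : ε * R ^ 2 ≤ M / 8 := by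
    rw [hε, div_mul_eq_mul_div, div_le_div_iff₀ (by positivity) (by positivity)]
    nlinarith
  set F : E → ℝ := V + ε • (fun z : E => ‖z‖ ^ 2) with hF
  have hns : ContDiff ℝ 2 (fun z : E => ‖z‖ ^ 2) := contDiff_norm_sq ℝ
  have hεs : ContDiff ℝ 2 (ε • (fun z : E => ‖z‖ ^ 2)) := contDiff_const.smul hns
  have hFs : ContDiff ℝ 2 F := hVs.add hεs
  obtain ⟨z, hzΩ, hz⟩ := hb.isCompact_closure.exists_isMaxOn ⟨x, subset_closure hx⟩
    hFs.continuous.continuousOn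
  have hzx : F x ≤ F z := hz (subset_closure hx)
  have hzR : ‖z‖ ≤ R := by
    have := closure_minimal hR Metric.isClosed_closedBall hzΩ
    simpa using this
  -- Three errors of size M/8 (mollification at x and at z, and the perturbation) leave W z ≥ 5M/8.
  -- A maximum point with such a value is at distance at least δ from the complement of Ω.
  have hWz : M / 2 < W z := by
    have h1 := abs_le.1 (hVW x)
    have h2 := abs_le.1 (hVW z)
    simp only [hF, Pi.add_apply, Pi.smul_apply, smul_eq_mul] at hzx
    have h3 : ε * ‖z‖ ^ 2 ≤ M / 8 := le_trans (by gcongr) hεR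
    have h4 : 0 ≤ ε * ‖x‖ ^ 2 := by positivity
    linarith
  have hball : Metric.ball z δ ⊆ Ω := fun y hy => by
    by_contra hyΩ
    have h1 : W y = 0 := indicator_of_notMem hyΩ _
    have h2 := hunif hy
    rw [h1, Real.dist_eq, zero_sub, abs_neg, abs_of_pos (by linarith)] at h2
    linarith
  have hmax : IsLocalMax F z := by
    filter_upwards [hΩ.mem_nhds (hball (Metric.mem_ball_self hδ))] with y hy
    exact hz (subset_closure hy)
  have hlap := laplacian_nonpos_of_isLocalMax hFs hmax
  rw [hF, ContDiffAt.laplacian_add hVs.contDiffAt hεs.contDiffAt,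
    InnerProductSpace.laplacian_smul ε hns.contDiffAt, laplacian_norm_sq] at hlap
  -- The mollifier centred at z is supported within δ/2 of z, hence in Ω, and is an admissible test
  -- function.
  have hV0 : Laplacian.laplacian V z = 0 := by
    rw [hV, laplacian_convolution hWc.locallyIntegrable (hρs (m := 2)) hρc]
    have hφ : ContDiff ℝ ∞ (fun y => ρn (z - y)) := hρs.comp (contDiff_const.sub contDiff_id)
    have hts : tsupport (fun y => ρn (z - y)) ⊆ Metric.closedBall z (δ / 2) := by
      refine closure_minimal (fun y hy => ?_) Metric.isClosed_closedBall
      have h1 : z - y ∈ tsupport ρn := subset_closure hy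
      rw [hρn, ρ.tsupport_normed_eq, mem_closedBall_zero_iff] at h1
      rw [Metric.mem_closedBall, dist_comm, dist_eq_norm]
      exact h1
    have hres := hharm _ hφ ((isCompact_closedBall z (δ / 2)).of_isClosed_subset
      (isClosed_tsupport _) hts)
      (hts.trans ((Metric.closedBall_subset_ball (by linarith)).trans hball))
    rw [← integral_indicator hΩ.measurableSet] at hres
    rw [← hres]
    congr 1
    funext y
    rw [← laplacian_comp_const_sub (hρs (m := 2)) z y]
    by_cases hy : y ∈ Ω
    · simp [hWdef, hy]
    · simp [hWdef, hy]
  rw [hV0, zero_add, smul_eq_mul] at hlap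
  have : 0 < Module.finrank ℝ E := Module.finrank_pos
  have h5 : 0 < ε * (2 * (Module.finrank ℝ E : ℝ)) := by positivity
  linarith

/-- A distributionally harmonic function which vanishes on the boundary is zero. -/
lemma eq_zero_of_integral_mul_laplacian_eq_zero {μ : Measure E} [μ.IsAddHaarMeasure]
    [Nontrivial E] {Ω : Set E} (hΩ : IsOpen Ω) (hb : Bornology.IsBounded Ω)
    {w : E → ℝ} (hw : ContinuousOn w (closure Ω)) (h0 : ∀ x ∈ frontier Ω, w x = 0)
    (hharm : ∀ φ : E → ℝ, ContDiff ℝ ∞ φ → HasCompactSupport φ → tsupport φ ⊆ Ω →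
      ∫ x in Ω, w x * Laplacian.laplacian φ x ∂μ = 0) {x : E} (hx : x ∈ closure Ω) : w x = 0 := by
  by_cases hxΩ : x ∈ Ω
  · refine le_antisymm (nonpos_of_integral_mul_laplacian_eq_zero hΩ hb hw h0 hharm hxΩ) ?_
    have := nonpos_of_integral_mul_laplacian_eq_zero (μ := μ) (w := fun x => -w x) hΩ hb hw.neg
      (fun x hx => by simp [h0 x hx]) (fun φ h1 h2 h3 => by
        simp only [neg_mul, integral_neg, hharm φ h1 h2 h3, neg_zero]) hxΩ
    linarith
  · exact h0 x ⟨hx, by rwa [hΩ.interior_eq]⟩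

end MaximumPrinciple

/-! ### Uniform estimates for potentials of measures with area growth. -/

section Potential

variable {E : Type*} [NormedAddCommGroup E] [MeasurableSpace E]

/-- `μ` has at most `d`-dimensional growth, with constant `C`. -/
def HasGrowth (μ : Measure E) (d : ℕ) (C : ENNReal) : Prop :=
  ∀ x : E, ∀ r : ℝ, 0 < r → μ (Metric.ball x r) ≤ C * ENNReal.ofReal (r ^ d)

variable {μ : Measure E} {d : ℕ} {C : ENNReal}

/-- This removes the diagonal y = x from the potentials: there Φ is evaluated at 0, where for p ≥ 1
the divergent integral only has the default value 0. -/
lemma HasGrowth.measure_singleton (h : HasGrowth μ d C) (hd : d ≠ 0) (hC : C ≠ ⊤) (x : E) :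
    μ {x} = 0 := by
  refine le_antisymm ?_ bot_le
  have hlim : Tendsto (fun r : ℝ => C * ENNReal.ofReal (r ^ d)) (𝓝[>] 0) (𝓝 0) := by
    have h1 : Tendsto (fun r : ℝ => ENNReal.ofReal (r ^ d)) (𝓝 0) (𝓝 0) := by
      have : Continuous fun r : ℝ => ENNReal.ofReal (r ^ d) :=
        ENNReal.continuous_ofReal.comp (continuous_pow d)
      simpa [hd] using this.tendsto 0
    have := ENNReal.Tendsto.const_mul (a := C)
      (h1.mono_left (nhdsWithin_le_nhds (s := Ioi 0))) (Or.inr hC)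
    simpa using this
  refine ge_of_tendsto hlim ?_
  filter_upwards [self_mem_nhdsWithin] with r hr
  exact (measure_mono (by simpa using hr)).trans (h x r hr)

lemma lintegral_ofReal_rpow_neg_half {T : ℝ} (hT : 0 < T) :
    ∫⁻ τ in Ioc 0 T, ENNReal.ofReal (τ ^ (-(1 / 2) : ℝ)) = ENNReal.ofReal (2 * √T) := by
  have hi : IntervalIntegrable (fun τ : ℝ => τ ^ (-(1 / 2) : ℝ)) volume 0 T :=
    intervalIntegral.intervalIntegrable_rpow' (by norm_num)
  rw [← ofReal_integral_eq_lintegral_ofReal hi.1, ← intervalIntegral.integral_of_le hT.le,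
    integral_rpow (Or.inl (by norm_num)), Real.sqrt_eq_rpow]
  · congr 1
    norm_num
    ring
  · filter_upwards [ae_restrict_mem measurableSet_Ioc] with x hx
    exact Real.rpow_nonneg hx.1.le _

variable [BorelSpace E]

/-- Layer-cake bound for the singular part of the fundamental solution. -/
lemma HasGrowth.lintegral_powerPrimitive_sub_le [SFinite μ] (h : HasGrowth μ d C) (hd : d ≠ 0) (hC : C ≠ ⊤)
    (x : E) {T : ℝ} (hT : 0 < T) :
    ∫⁻ y, ENNReal.ofReal (powerPrimitive ((d + 1 : ℝ) / 2) T
        - powerPrimitive ((d + 1 : ℝ) / 2) (‖x - y‖ ^ 2)) ∂μ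
      ≤ C * ENNReal.ofReal (2 * √T) := by
  set p : ℝ := (d + 1 : ℝ) / 2 with hp
  have hne : ∀ᵐ y ∂μ, y ≠ x := by
    rw [ae_iff]; simpa using h.measure_singleton hd hC x
  set S : Set (E × ℝ) := {z | ‖x - z.1‖ ^ 2 < z.2} with hS
  have hSm : MeasurableSet S := by
    apply measurableSet_lt <;> fun_prop
  -- Layer cake: Φ(T) - Φ(s) is the integral of τ^(-p) over s < τ ≤ T, here with s = ‖x - y‖².
  -- Points with s ≥ T are cut off by `ENNReal.ofReal`.
  set k : E → ℝ → ENNReal := fun y τ => S.indicator (fun z => ENNReal.ofReal (z.2 ^ (-p))) (y, τ)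
    with hk
  have hkm : Measurable (Function.uncurry k) :=
    (Measurable.indicator (f := fun z : E × ℝ => ENNReal.ofReal (z.2 ^ (-p))) (by fun_prop) hSm)
  calc _ ≤ ∫⁻ y, (∫⁻ τ in Ioc 0 T, k y τ) ∂μ := by
        refine lintegral_mono_ae ?_
        filter_upwards [hne] with y hy
        have hs : 0 < ‖x - y‖ ^ 2 := by
          have : 0 < ‖x - y‖ := norm_pos_iff.2 (sub_ne_zero.2 (Ne.symm hy))
          positivity
        rcases le_total T (‖x - y‖ ^ 2) with hle | hle
        · rw [ENNReal.ofReal_of_nonpos (by linarith [powerPrimitive_mono p hT hle])]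
          exact bot_le
        · rw [ofReal_powerPrimitive_sub p hs hle]
          calc _ = ∫⁻ τ in Ioc (‖x - y‖ ^ 2) T, k y τ := by
                refine setLIntegral_congr_fun measurableSet_Ioc fun τ hτ => ?_
                simp only [hk]
                rw [indicator_of_mem (by exact hτ.1)]
            _ ≤ _ := lintegral_mono_set (Ioc_subset_Ioc_left hs.le)
    _ = ∫⁻ τ in Ioc 0 T, ∫⁻ y, k y τ ∂μ := lintegral_lintegral_swap hkm.aemeasurable
    -- For fixed τ the section is the ball of radius √τ, of measure at most C τ^(d/2). Since p = (d
    -- + 1)/2, the product with τ^(-p) is the integrable power τ^(-1/2).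
    _ ≤ ∫⁻ τ in Ioc 0 T, C * ENNReal.ofReal (τ ^ (-(1 / 2) : ℝ)) := by
        refine setLIntegral_mono (by fun_prop) fun τ hτ => ?_
        have hτ0 : 0 < √τ := Real.sqrt_pos.2 hτ.1
        have hki : (fun y => k y τ)
            = (Metric.ball x (√τ)).indicator fun _ => ENNReal.ofReal (τ ^ (-p)) := by
          funext y
          simp only [hk, indicator, hS, mem_ofPred_eq, Metric.mem_ball, dist_comm y x,
            dist_eq_norm, Real.lt_sqrt (norm_nonneg _)]
        rw [hki, lintegral_indicator Metric.isOpen_ball.measurableSet, setLIntegral_const]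
        calc _ ≤ ENNReal.ofReal (τ ^ (-p)) * (C * ENNReal.ofReal (√τ ^ d)) := by
              gcongr; exact h x _ hτ0
          _ = C * (ENNReal.ofReal (τ ^ (-p)) * ENNReal.ofReal (√τ ^ d)) := by ring
          _ = _ := by
            rw [← ENNReal.ofReal_mul (Real.rpow_nonneg hτ.1.le _), Real.sqrt_eq_rpow,
              ← Real.rpow_natCast, ← Real.rpow_mul hτ.1.le, ← Real.rpow_add hτ.1]
            congr 3
            rw [hp]; ring
    _ = _ := by
        rw [lintegral_const_mul _ (by fun_prop), lintegral_ofReal_rpow_neg_half hT]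

/-- Split at s = ‖x - y‖² = T. For s ≥ T the integrand is at most T^(-p) t, as τ^(-p) is decreasing.
For s ≤ T, monotonicity gives Φ(s + t) ≤ Φ(T + t) ≤ Φ(T) + T^(-p) t, and the layer-cake bound
controls Φ(T) - Φ(s). -/
lemma HasGrowth.lintegral_powerPrimitive_add_sub_le [SFinite μ] (h : HasGrowth μ d C) (hd : d ≠ 0)
    (hC : C ≠ ⊤) (x : E) {T t : ℝ} (hT : 0 < T) (ht : 0 ≤ t) :
    ∫⁻ y, ENNReal.ofReal (powerPrimitive ((d + 1 : ℝ) / 2) (‖x - y‖ ^ 2 + t)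
        - powerPrimitive ((d + 1 : ℝ) / 2) (‖x - y‖ ^ 2)) ∂μ
      ≤ ENNReal.ofReal (T ^ (-((d + 1 : ℝ) / 2)) * t) * μ univ
        + C * ENNReal.ofReal (2 * √T) := by
  set p : ℝ := (d + 1 : ℝ) / 2 with hp
  have hp0 : 0 ≤ p := by positivity
  have hne : ∀ᵐ y ∂μ, y ≠ x := by
    rw [ae_iff]; simpa using h.measure_singleton hd hC x
  calc _ ≤ ∫⁻ y, (ENNReal.ofReal (T ^ (-p) * t) + ENNReal.ofReal (powerPrimitive p T
        - powerPrimitive p (‖x - y‖ ^ 2))) ∂μ := by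
        refine lintegral_mono_ae ?_
        filter_upwards [hne] with y hy
        have hs : 0 < ‖x - y‖ ^ 2 := by
          have : 0 < ‖x - y‖ := norm_pos_iff.2 (sub_ne_zero.2 (Ne.symm hy))
          positivity
        set s := ‖x - y‖ ^ 2
        have hTt : 0 ≤ T ^ (-p) * t := by positivity
        rcases le_total T s with hle | hle
        · refine le_trans (ENNReal.ofReal_le_ofReal ?_) le_self_add
          calc _ ≤ s ^ (-p) * (s + t - s) := powerPrimitive_sub_le hp0 hs (by linarith)
            _ ≤ T ^ (-p) * t := by
              rw [add_sub_cancel_left]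
              exact mul_le_mul_of_nonneg_right
                (Real.rpow_le_rpow_of_nonpos hT hle (by linarith)) ht
        · rw [← ENNReal.ofReal_add hTt (by linarith [powerPrimitive_mono p hs hle])]
          refine ENNReal.ofReal_le_ofReal ?_
          have h1 : powerPrimitive p (s + t) ≤ powerPrimitive p (T + t) :=
            powerPrimitive_mono p (by linarith) (by linarith)
          have h2 := powerPrimitive_sub_le hp0 hT (show T ≤ T + t by linarith)
          rw [add_sub_cancel_left] at h2
          linarith
    _ ≤ _ := by
        rw [lintegral_add_left (by fun_prop), lintegral_const]
        gcongr
        exact h.lintegral_powerPrimitive_sub_le hd hC x hT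

lemma HasGrowth.aestronglyMeasurable_powerPrimitive
    [SecondCountableTopology E] (h : HasGrowth μ d C) (hd : d ≠ 0)
    (hC : C ≠ ⊤) (p : ℝ) (x : E) {t : ℝ} (ht : 0 ≤ t) :
    AEStronglyMeasurable (fun y => powerPrimitive p (‖x - y‖ ^ 2 + t)) μ := by
  have hne : ∀ᵐ y ∂μ, y ∈ ({x}ᶜ : Set E) := by
    rw [ae_iff]; simpa using h.measure_singleton hd hC x
  rw [← Measure.restrict_eq_self_of_ae_mem hne]
  refine ContinuousOn.aestronglyMeasurable ?_ (measurableSet_singleton x).compl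
  refine (continuousOn_powerPrimitive p).comp (by fun_prop) fun y hy => ?_
  have : 0 < ‖x - y‖ := norm_pos_iff.2 (sub_ne_zero.2 (Ne.symm hy))
  exact mem_Ioi.2 (by positivity)

variable [SecondCountableTopology E] [IsFiniteMeasure μ]

lemma HasGrowth.integrable_powerPrimitive_add_sub (h : HasGrowth μ d C) (hd : d ≠ 0)
    (hC : C ≠ ⊤) (x : E) {t : ℝ} (ht : 0 ≤ t) :
    Integrable (fun y => powerPrimitive ((d + 1 : ℝ) / 2) (‖x - y‖ ^ 2 + t)
        - powerPrimitive ((d + 1 : ℝ) / 2) (‖x - y‖ ^ 2)) μ := by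
  have hm0 := h.aestronglyMeasurable_powerPrimitive hd hC ((d + 1 : ℝ) / 2) x le_rfl
  simp only [add_zero] at hm0
  refine ⟨(h.aestronglyMeasurable_powerPrimitive hd hC _ x ht).sub hm0, ?_⟩
  have hne : ∀ᵐ y ∂μ, y ≠ x := by
    rw [ae_iff]; simpa using h.measure_singleton hd hC x
  rw [hasFiniteIntegral_iff_ofReal]
  · refine (h.lintegral_powerPrimitive_add_sub_le hd hC x one_pos ht).trans_lt ?_
    exact ENNReal.add_lt_top.2 ⟨ENNReal.mul_lt_top ENNReal.ofReal_lt_top (measure_lt_top _ _),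
      ENNReal.mul_lt_top hC.lt_top ENNReal.ofReal_lt_top⟩
  · filter_upwards [hne] with y hy
    have : 0 < ‖x - y‖ := norm_pos_iff.2 (sub_ne_zero.2 (Ne.symm hy))
    exact sub_nonneg.2 (powerPrimitive_mono _ (by positivity) (by linarith))

lemma HasGrowth.exists_integral_powerPrimitive_add_sub_le (h : HasGrowth μ d C) (hd : d ≠ 0)
    (hC : C ≠ ⊤) {ε : ℝ} (hε : 0 < ε) :
    ∃ t₀ > 0, ∀ t ∈ Ioc 0 t₀, ∀ x : E,
      ∫ y, (powerPrimitive ((d + 1 : ℝ) / 2) (‖x - y‖ ^ 2 + t)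
        - powerPrimitive ((d + 1 : ℝ) / 2) (‖x - y‖ ^ 2)) ∂μ ≤ ε := by
  set p : ℝ := (d + 1 : ℝ) / 2 with hp
  -- The cut-off T is fixed first, then t₀ in terms of T; neither depends on x.
  obtain ⟨T, hT, hTε⟩ : ∃ T : ℝ, 0 < T ∧ C.toReal * (2 * √T) ≤ ε / 2 := by
    have hc : Continuous fun T : ℝ => C.toReal * (2 * √T) := by fun_prop
    have h1 : ∀ᶠ T in 𝓝[>] (0 : ℝ), C.toReal * (2 * √T) < ε / 2 := by
      refine (hc.tendsto 0).mono_left nhdsWithin_le_nhds |>.eventually_lt_const ?_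
      simpa using hε
    obtain ⟨T, hT1, hT2⟩ := (h1.and self_mem_nhdsWithin).exists
    exact ⟨T, hT2, hT1.le⟩
  set m := μ.real univ with hm
  have hm0 : 0 ≤ m := measureReal_nonneg
  have hTp : 0 < T ^ (-p) := Real.rpow_pos_of_pos hT _
  refine ⟨ε / (2 * (T ^ (-p) * m + 1)), by positivity, fun t ht x => ?_⟩
  have hne : ∀ᵐ y ∂μ, y ≠ x := by
    rw [ae_iff]; simpa using h.measure_singleton hd hC x
  rw [integral_eq_lintegral_of_nonneg_ae]
  · refine ENNReal.toReal_le_of_le_ofReal hε.le ?_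
    refine (h.lintegral_powerPrimitive_add_sub_le hd hC x hT ht.1.le).trans ?_
    have h1 : μ univ = ENNReal.ofReal m := by simp [hm]
    have h2 : C = ENNReal.ofReal C.toReal := (ENNReal.ofReal_toReal hC).symm
    rw [h1, h2, ← ENNReal.ofReal_mul (by have := ht.1; positivity),
      ← ENNReal.ofReal_mul ENNReal.toReal_nonneg, ← ENNReal.ofReal_add
      (by have := ht.1; positivity) (by positivity)]
    refine ENNReal.ofReal_le_ofReal ?_
    have h3 := ht.2
    rw [le_div_iff₀ (by positivity)] at h3
    have h4 := ht.1
    nlinarith [h4]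
  · filter_upwards [hne] with y hy
    have : 0 < ‖x - y‖ := norm_pos_iff.2 (sub_ne_zero.2 (Ne.symm hy))
    exact sub_nonneg.2 (powerPrimitive_mono _ (by positivity) (by linarith [ht.1]))
  · exact (h.integrable_powerPrimitive_add_sub hd hC x ht.1.le).1

end Potential

/-! ### The Green kernel of the ball and continuity of its potential. -/

section GreenPotential

variable {E : Type*} [NormedAddCommGroup E] [InnerProductSpace ℝ E]

/-- Cauchy–Schwarz. It keeps the Kelvin term away from its singularity as long as ‖x‖ ≤ 1 and ‖y‖ ≤
ρ < 1. -/
lemma one_sub_mul_sq_le_quad (x y : E) : (1 - ‖y‖ * ‖x‖) ^ 2 ≤ quad (‖y‖ ^ 2) 1 y x := by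
  have := real_inner_le_norm y x
  rw [quad]
  nlinarith

/-- The source of the boundary condition: since the arguments themselves agree on the sphere, the
kernel vanishes there for every regularization t. -/
lemma quad_eq_of_norm_eq_one {x : E} (hx : ‖x‖ = 1) (y : E) :
    quad (‖y‖ ^ 2) 1 y x = quad 1 (‖y‖ ^ 2) y x := by
  simp [quad, hx]; ring

lemma quad_one_nonneg (x y : E) : 0 ≤ quad 1 (‖y‖ ^ 2) y x := by
  rw [quad_one_normSq]; positivity

lemma quad_kelvin_nonneg (x y : E) : 0 ≤ quad (‖y‖ ^ 2) 1 y x :=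
  (sq_nonneg _).trans (one_sub_mul_sq_le_quad x y)

lemma quad_kelvin_ge {ρ : ℝ} (hρ : ρ < 1) {x y : E} (hx : ‖x‖ ≤ 1) (hy : ‖y‖ ≤ ρ) :
    (1 - ρ) ^ 2 ≤ quad (‖y‖ ^ 2) 1 y x := by
  refine le_trans ?_ (one_sub_mul_sq_le_quad x y)
  have : ‖y‖ * ‖x‖ ≤ ρ * 1 := mul_le_mul hy hx (norm_nonneg _) ((norm_nonneg _).trans hy)
  exact pow_le_pow_left₀ (by linarith) (by linarith) 2

/-- Up to a positive factor, the Green function of the unit ball, regularized by `t ≥ 0`. -/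
noncomputable def greenKernel (p t : ℝ) (x y : E) : ℝ :=
  powerPrimitive p (quad 1 (‖y‖ ^ 2) y x + t) - powerPrimitive p (quad (‖y‖ ^ 2) 1 y x + t)

lemma greenKernel_of_norm_eq_one (p t : ℝ) {x : E} (hx : ‖x‖ = 1) (y : E) :
    greenKernel p t x y = 0 := by
  rw [greenKernel, quad_eq_of_norm_eq_one hx, sub_self]

lemma continuous_uncurry_greenKernel (p : ℝ) {t : ℝ} (ht : 0 < t) :
    Continuous (Function.uncurry (greenKernel p t : E → E → ℝ)) := by
  have h : ∀ F : E × E → ℝ, Continuous F → (∀ z, 0 ≤ F z) →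
      Continuous fun z => powerPrimitive p (F z + t) := fun F hF h0 =>
    (continuousOn_powerPrimitive p).comp_continuous (by fun_prop)
      fun z => mem_Ioi.2 (by linarith [h0 z])
  refine (h (fun z => quad 1 (‖z.2‖ ^ 2) z.2 z.1) ?_ fun z => quad_one_nonneg _ _).sub
    (h (fun z => quad (‖z.2‖ ^ 2) 1 z.2 z.1) ?_ fun z => quad_kelvin_nonneg _ _)
  · simp only [quad]; fun_prop
  · simp only [quad]; fun_prop

lemma exists_greenKernel_bound [FiniteDimensional ℝ E] (p : ℝ) {t : ℝ} (ht : 0 < t) :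
    ∃ B : ℝ, ∀ x y : E, ‖x‖ ≤ 1 → ‖y‖ ≤ 1 → |greenKernel p t x y| ≤ B := by
  obtain ⟨B, hB⟩ := ((isCompact_closedBall (0 : E) 1).prod
    (isCompact_closedBall (0 : E) 1)).exists_bound_of_continuousOn
    (continuous_uncurry_greenKernel p ht).continuousOn
  exact ⟨B, fun x y hx hy => hB (x, y) (by simp [hx, hy])⟩

variable [MeasurableSpace E]

/-- The Green potential of the measure `g dμ`, regularized by `t ≥ 0`. -/
noncomputable def greenPotential (p t : ℝ) (μ : Measure E) (g : E → ℝ) (x : E) : ℝ :=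
  ∫ y, greenKernel p t x y * g y ∂μ

lemma greenPotential_of_norm_eq_one (p t : ℝ) (μ : Measure E) (g : E → ℝ) {x : E}
    (hx : ‖x‖ = 1) : greenPotential p t μ g x = 0 := by
  simp [greenPotential, greenKernel_of_norm_eq_one p t hx]

variable [FiniteDimensional ℝ E] [BorelSpace E] {μ : Measure E} {d : ℕ} {C : ENNReal} {ρ : ℝ}
  {g : E → ℝ}

lemma integrable_greenKernel_mul (p : ℝ) {t : ℝ} (ht : 0 < t) (hg : Integrable g μ)
    (hμ : ∀ᵐ y ∂μ, ‖y‖ ≤ 1) {x : E} (hx : ‖x‖ ≤ 1) :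
    Integrable (fun y => greenKernel p t x y * g y) μ := by
  obtain ⟨B, hB⟩ := exists_greenKernel_bound (E := E) p ht
  refine hg.bdd_mul (c := B) ?_ ?_
  · exact ((continuous_uncurry_greenKernel p ht).comp
      (Continuous.prodMk_right x)).aestronglyMeasurable
  · filter_upwards [hμ] with y hy using hB x y hx hy

lemma continuousOn_greenPotential_of_pos (p : ℝ) {t : ℝ} (ht : 0 < t) (hg : Integrable g μ)
    (hμ : ∀ᵐ y ∂μ, ‖y‖ ≤ 1) : ContinuousOn (greenPotential p t μ g) (Metric.closedBall 0 1) := by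
  obtain ⟨B, hB⟩ := exists_greenKernel_bound (E := E) p ht
  refine continuousOn_of_dominated (bound := fun y => B * |g y|) ?_ ?_ ?_ ?_
  · intro x hx
    exact (integrable_greenKernel_mul p ht hg hμ (by simpa using hx)).1
  · intro x hx
    filter_upwards [hμ] with y hy
    rw [Real.norm_eq_abs, abs_mul]
    exact mul_le_mul_of_nonneg_right (hB x y (by simpa using hx) hy) (abs_nonneg _)
  · exact hg.abs.const_mul B
  · refine ae_of_all _ fun y => ?_
    exact (((continuous_uncurry_greenKernel p ht).comp
      (Continuous.prodMk_left y)).mul continuous_const).continuousOn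

variable [IsFiniteMeasure μ]

/-- The regularization error of the Green function is small in `L¹(μ)`, uniformly in `x`. -/
lemma HasGrowth.exists_integral_greenKernel_sub_le (h : HasGrowth μ d C) (hd : d ≠ 0)
    (hC : C ≠ ⊤) (hρ : ρ < 1) (hμ : ∀ᵐ y ∂μ, ‖y‖ ≤ ρ) {ε : ℝ} (hε : 0 < ε) :
    ∃ t₀ > 0, ∀ t ∈ Ioc 0 t₀, ∀ x : E, ‖x‖ ≤ 1 →
      Integrable (fun y => greenKernel ((d + 1 : ℝ) / 2) t x y
        - greenKernel ((d + 1 : ℝ) / 2) 0 x y) μ ∧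
      ∫ y, |greenKernel ((d + 1 : ℝ) / 2) t x y
        - greenKernel ((d + 1 : ℝ) / 2) 0 x y| ∂μ ≤ ε := by
  set p : ℝ := (d + 1 : ℝ) / 2 with hp
  have hp0 : 0 ≤ p := by positivity
  obtain ⟨t₁, ht₁, h₁⟩ := h.exists_integral_powerPrimitive_add_sub_le hd hC (half_pos hε)
  set κ : ℝ := (1 - ρ) ^ 2 with hκ
  have hκ0 : 0 < κ := by have : 0 < 1 - ρ := by linarith
                         positivity
  set m := μ.real univ with hm
  have hm0 : 0 ≤ m := measureReal_nonneg
  have hκp : 0 < κ ^ (-p) := Real.rpow_pos_of_pos hκ0 _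
  refine ⟨min t₁ (ε / (2 * (κ ^ (-p) * m + 1))), lt_min ht₁ (by positivity), fun t ht x hx => ?_⟩
  have ht1 : t ∈ Ioc 0 t₁ := ⟨ht.1, ht.2.trans (min_le_left _ _)⟩
  have ht2 := ht.2.trans (min_le_right _ _)
  -- A is the error of the singular term, small in L¹ by the growth bound; K is that of the Kelvin
  -- term, at most κ^(-p) t pointwise. Both are nonnegative, so |A - K| ≤ A + κ^(-p) t.
  set A : E → ℝ := fun y => powerPrimitive p (‖x - y‖ ^ 2 + t) - powerPrimitive p (‖x - y‖ ^ 2)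
  set K : E → ℝ := fun y => powerPrimitive p (quad (‖y‖ ^ 2) 1 y x + t)
    - powerPrimitive p (quad (‖y‖ ^ 2) 1 y x)
  have hA : Integrable A μ := h.integrable_powerPrimitive_add_sub hd hC x ht.1.le
  have hA0 : ∀ᵐ y ∂μ, 0 ≤ A y := by
    have hne : ∀ᵐ y ∂μ, y ≠ x := by
      rw [ae_iff]; simpa using h.measure_singleton hd hC x
    filter_upwards [hne] with y hy
    have : 0 < ‖x - y‖ := norm_pos_iff.2 (sub_ne_zero.2 (Ne.symm hy))
    exact sub_nonneg.2 (powerPrimitive_mono _ (by positivity) (by linarith [ht.1]))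
  have hK0 : ∀ᵐ y ∂μ, 0 ≤ K y ∧ K y ≤ κ ^ (-p) * t := by
    filter_upwards [hμ] with y hy
    have hq : κ ≤ quad (‖y‖ ^ 2) 1 y x := quad_kelvin_ge hρ hx hy
    have hq0 := hκ0.trans_le hq
    refine ⟨sub_nonneg.2 (powerPrimitive_mono _ hq0 (by linarith [ht.1])), ?_⟩
    refine (powerPrimitive_sub_le hp0 hq0 (by linarith [ht.1])).trans ?_
    rw [add_sub_cancel_left]
    exact mul_le_mul_of_nonneg_right
      (Real.rpow_le_rpow_of_nonpos hκ0 hq (by linarith)) ht.1.le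
  have hKm : AEStronglyMeasurable K μ := by
    have hmem : ∀ᵐ y ∂μ, y ∈ Metric.closedBall (0 : E) ρ := by
      filter_upwards [hμ] with y hy using by simpa using hy
    rw [← Measure.restrict_eq_self_of_ae_mem hmem]
    refine ContinuousOn.aestronglyMeasurable ?_ measurableSet_closedBall
    have hqc : Continuous fun y : E => quad (‖y‖ ^ 2) 1 y x := by
      simp only [quad]; fun_prop
    have hq0 : ∀ y ∈ Metric.closedBall (0 : E) ρ, 0 < quad (‖y‖ ^ 2) 1 y x := fun y hy =>
      hκ0.trans_le (quad_kelvin_ge hρ hx (by simpa using hy))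
    exact ((continuousOn_powerPrimitive p).comp (hqc.continuousOn.add continuousOn_const)
      fun y hy => mem_Ioi.2 (add_pos (hq0 y hy) ht.1)).sub
      ((continuousOn_powerPrimitive p).comp hqc.continuousOn fun y hy => hq0 y hy)
  have hK : Integrable K μ := by
    refine Integrable.of_bound hKm (κ ^ (-p) * t) ?_
    filter_upwards [hK0] with y hy
    rw [Real.norm_eq_abs, abs_of_nonneg hy.1]; exact hy.2
  have hAK : (fun y => greenKernel p t x y - greenKernel p 0 x y) = fun y => A y - K y := by
    funext y
    simp only [greenKernel, A, K, quad_one_normSq, add_zero]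
    ring
  rw [hAK]
  refine ⟨hA.sub hK, ?_⟩
  have hAK' : ∀ y, greenKernel p t x y - greenKernel p 0 x y = A y - K y := congr_fun hAK
  simp_rw [hAK']
  calc ∫ y, |A y - K y| ∂μ ≤ ∫ y, (A y + κ ^ (-p) * t) ∂μ := by
        refine integral_mono_ae (hA.sub hK).abs (hA.add (integrable_const _)) ?_
        filter_upwards [hA0, hK0] with y h1 h2
        exact (abs_sub_le_iff.2 ⟨by linarith, by linarith⟩)
    _ = ∫ y, A y ∂μ + κ ^ (-p) * t * m := by
        rw [integral_add hA (integrable_const _), integral_const, smul_eq_mul, mul_comm m]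
    _ ≤ ε / 2 + ε / 2 := by
        refine add_le_add (h₁ t ht1 x) ?_
        rw [le_div_iff₀ (by positivity)] at ht2
        nlinarith [ht.1]
    _ = ε := by ring

/-- The regularized potentials converge to the potential uniformly on the closed unit ball. -/
lemma HasGrowth.tendstoUniformlyOn_greenPotential (h : HasGrowth μ d C) (hd : d ≠ 0)
    (hC : C ≠ ⊤) (hρ : ρ < 1) (hμ : ∀ᵐ y ∂μ, ‖y‖ ≤ ρ) (hg : MemLp g ⊤ μ) :
    TendstoUniformlyOn (fun t => greenPotential ((d + 1 : ℝ) / 2) t μ g)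
      (greenPotential ((d + 1 : ℝ) / 2) 0 μ g) (𝓝[>] 0) (Metric.closedBall 0 1) := by
  set p : ℝ := (d + 1 : ℝ) / 2 with hp
  obtain ⟨M, hM0, hM⟩ : ∃ M : ℝ, 0 ≤ M ∧ ∀ᵐ y ∂μ, ‖g y‖ ≤ M := by
    refine ⟨(eLpNorm g ⊤ μ).toReal, ENNReal.toReal_nonneg, ?_⟩
    have := ae_le_eLpNormEssSup (f := g) (μ := μ)
    filter_upwards [this] with y hy
    rw [← eLpNorm_exponent_top] at hy
    have h2 := ENNReal.toReal_mono hg.2.ne hy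
    simpa using h2
  have hgi : Integrable g μ := hg.integrable le_top
  have hμ1 : ∀ᵐ y ∂μ, ‖y‖ ≤ 1 := by filter_upwards [hμ] with y hy using hy.trans hρ.le
  rw [Metric.tendstoUniformlyOn_iff]
  intro ε hε
  obtain ⟨t₀, ht₀, hbound⟩ := h.exists_integral_greenKernel_sub_le hd hC hρ hμ
    (ε := ε / (2 * (M + 1))) (by positivity)
  filter_upwards [Ioc_mem_nhdsGT ht₀] with t ht x hx
  have hx1 : ‖x‖ ≤ 1 := by simpa using hx
  obtain ⟨hi, hle⟩ := hbound t ht x hx1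
  have hdg : Integrable (fun y => (greenKernel p t x y - greenKernel p 0 x y) * g y) μ :=
    hi.mul_bdd hg.1 hM
  have hit := integrable_greenKernel_mul p ht.1 hgi hμ1 hx1
  -- The singular kernel is integrable against g as the bounded regularized kernel minus the
  -- integrable error.
  have hi0 : Integrable (fun y => greenKernel p 0 x y * g y) μ := by
    refine (hit.sub hdg).congr (ae_of_all _ fun y => ?_)
    simp only [Pi.sub_apply]; ring
  rw [dist_comm, Real.dist_eq, greenPotential, greenPotential, ← integral_sub hit hi0]
  calc |∫ y, (greenKernel p t x y * g y - greenKernel p 0 x y * g y) ∂μ|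
      ≤ ∫ y, |greenKernel p t x y - greenKernel p 0 x y| * M ∂μ := by
        rw [← Real.norm_eq_abs (∫ y, _ ∂μ)]
        refine norm_integral_le_of_norm_le (hi.abs.mul_const M) ?_
        filter_upwards [hM] with y hy
        rw [← sub_mul, norm_mul]
        exact mul_le_mul_of_nonneg_left hy (abs_nonneg _)
    _ ≤ ε / (2 * (M + 1)) * M := by
        rw [integral_mul_const]
        exact mul_le_mul_of_nonneg_right hle hM0
    _ < ε := by
        rw [div_mul_eq_mul_div, div_lt_iff₀ (by positivity)]
        nlinarith

lemma HasGrowth.continuousOn_greenPotential (h : HasGrowth μ d C) (hd : d ≠ 0)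
    (hC : C ≠ ⊤) (hρ : ρ < 1) (hμ : ∀ᵐ y ∂μ, ‖y‖ ≤ ρ) (hg : MemLp g ⊤ μ) :
    ContinuousOn (greenPotential ((d + 1 : ℝ) / 2) 0 μ g) (Metric.closedBall 0 1) := by
  refine (h.tendstoUniformlyOn_greenPotential hd hC hρ hμ hg).continuousOn
    (Eventually.frequently ?_)
  filter_upwards [self_mem_nhdsWithin] with t ht
  exact continuousOn_greenPotential_of_pos _ ht (hg.integrable le_top)
    (by filter_upwards [hμ] with y hy using hy.trans hρ.le)

end GreenPotential

/-! ### The Poisson equation for the Green potential. -/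

section PoissonEquation

variable {E : Type*} [NormedAddCommGroup E] [InnerProductSpace ℝ E]

/-- The Laplacian of `powerPrimitive (n / 2) (1 + ‖x‖²)` on an `n`-dimensional space. -/
noncomputable def bubble (E : Type*) [NormedAddCommGroup E] [InnerProductSpace ℝ E] (x : E) : ℝ :=
  2 * Module.finrank ℝ E * (1 + ‖x‖ ^ 2) ^ (-(Module.finrank ℝ E / 2 : ℝ) - 1)

lemma bubble_nonneg (x : E) : 0 ≤ bubble E x := by unfold bubble; positivity

lemma continuous_bubble : Continuous (bubble E) :=
  continuous_const.mul ((by fun_prop : Continuous fun x : E => 1 + ‖x‖ ^ 2).rpow_const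
    fun x => Or.inl (by positivity))

/-- With t = m⁻² the right-hand side is the Laplacian of Φ(‖z‖² + t). The regularized point sources
are therefore the mass-preserving dilations of one profile. -/
lemma pow_mul_bubble_smul {m : ℝ} (hm : 0 < m) (z : E) :
    m ^ Module.finrank ℝ E * bubble E (m • z) = 2 * Module.finrank ℝ E * (m ^ 2)⁻¹ *
      (‖z‖ ^ 2 + (m ^ 2)⁻¹) ^ (-(Module.finrank ℝ E / 2 : ℝ) - 1) := by
  have h1 : 1 + ‖m • z‖ ^ 2 = m ^ 2 * (‖z‖ ^ 2 + (m ^ 2)⁻¹) := by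
    rw [norm_smul, mul_pow, Real.norm_eq_abs, sq_abs]
    field_simp
    ring
  have h2 : (m ^ 2 : ℝ) ^ (-(Module.finrank ℝ E / 2 : ℝ) - 1)
      = (m ^ Module.finrank ℝ E)⁻¹ * (m ^ 2)⁻¹ := by
    rw [Real.rpow_sub (by positivity), Real.rpow_neg (by positivity), Real.rpow_one,
      ← Real.rpow_natCast m 2, ← Real.rpow_mul hm.le, ← Real.rpow_natCast m (Module.finrank ℝ E),
      div_eq_mul_inv]
    congr 3
    push_cast
    ring
  rw [bubble, h1, Real.mul_rpow (by positivity) (by positivity), h2]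
  field_simp

/-- The decay needed for the dilated bubbles to act as an approximate identity; the product is at
most 2n / (1 + ‖x‖²). -/
lemma tendsto_norm_pow_mul_bubble : Tendsto (fun x : E => ‖x‖ ^ Module.finrank ℝ E * bubble E x)
    (Bornology.cobounded E) (𝓝 0) := by
  have hlim : Tendsto (fun x : E => 2 * (Module.finrank ℝ E : ℝ) * (1 + ‖x‖ ^ 2)⁻¹)
      (Bornology.cobounded E) (𝓝 (2 * (Module.finrank ℝ E : ℝ) * 0)) := by
    refine Tendsto.const_mul _ (tendsto_inv_atTop_zero.comp ?_)
    exact tendsto_atTop_add_const_left _ _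
      ((tendsto_pow_atTop two_ne_zero).comp tendsto_norm_cobounded_atTop)
  rw [mul_zero] at hlim
  refine squeeze_zero (fun x => mul_nonneg (by positivity) (bubble_nonneg x)) (fun x => ?_) hlim
  have h1 : ‖x‖ ^ Module.finrank ℝ E ≤ (1 + ‖x‖ ^ 2) ^ (Module.finrank ℝ E / 2 : ℝ) := by
    have h2 : ‖x‖ ^ Module.finrank ℝ E = (‖x‖ ^ 2) ^ (Module.finrank ℝ E / 2 : ℝ) := by
      rw [← Real.rpow_natCast, ← Real.rpow_natCast, ← Real.rpow_mul (norm_nonneg _)]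
      congr 1
      push_cast
      ring
    rw [h2]
    exact Real.rpow_le_rpow (by positivity) (by linarith) (by positivity)
  have h3 : (0 : ℝ) < 1 + ‖x‖ ^ 2 := by positivity
  have h4 := Real.rpow_pos_of_pos h3 (Module.finrank ℝ E / 2 : ℝ)
  rw [bubble, Real.rpow_sub h3, Real.rpow_neg h3.le, Real.rpow_one]
  calc _ ≤ (1 + ‖x‖ ^ 2) ^ (Module.finrank ℝ E / 2 : ℝ) * (2 * Module.finrank ℝ E *
        (((1 + ‖x‖ ^ 2) ^ (Module.finrank ℝ E / 2 : ℝ))⁻¹ / (1 + ‖x‖ ^ 2))) := by gcongr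
    _ = _ := by field_simp

variable [FiniteDimensional ℝ E] [MeasurableSpace E] [BorelSpace E] {ν : Measure E} [ν.IsAddHaarMeasure]

lemma integrable_bubble : Integrable (bubble E) ν := by
  have h := integrable_rpow_neg_one_add_norm_sq (E := E) (μ := ν)
    (r := (Module.finrank ℝ E : ℝ) + 2) (by linarith)
  refine (h.const_mul (2 * Module.finrank ℝ E : ℝ)).congr (ae_of_all _ fun x => ?_)
  simp only [bubble]
  congr 2
  ring

lemma integral_bubble_pos [Nontrivial E] : 0 < ∫ x, bubble E x ∂ν := by
  refine integral_pos_of_integrable_nonneg_nonzero continuous_bubble integrable_bubble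
    bubble_nonneg (x := 0) ?_
  have : 0 < Module.finrank ℝ E := Module.finrank_pos
  simp [bubble, this.ne']

lemma tendsto_integral_bubble_mul [Nontrivial E] {φ : E → ℝ} (hφ : Continuous φ)
    (hc : HasCompactSupport φ) (y : E) :
    Tendsto (fun m : ℝ => ∫ x, m ^ Module.finrank ℝ E * bubble E (m • (x - y)) * φ x ∂ν) atTop
      (𝓝 ((∫ x, bubble E x ∂ν) * φ y)) := by
  set c := ∫ x, bubble E x ∂ν with hcdef
  have hc0 : 0 < c := integral_bubble_pos
  have h := tendsto_integral_comp_smul_smul_of_integrable' (μ := ν)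
    (φ := fun x => c⁻¹ * bubble E x) (g := φ) (x₀ := y)
    (fun x => mul_nonneg (by positivity) (bubble_nonneg x))
    (by rw [integral_const_mul, ← hcdef, inv_mul_cancel₀ hc0.ne'])
    (by
      have := (tendsto_norm_pow_mul_bubble (E := E)).const_mul c⁻¹
      rw [mul_zero] at this
      refine this.congr fun x => by ring)
    (hφ.integrable_of_hasCompactSupport hc) hφ.continuousAt
  refine (h.const_mul c).congr fun m => ?_
  rw [← integral_const_mul]
  congr 1
  funext x
  have : bubble E (m • (y - x)) = bubble E (m • (x - y)) := by
    simp only [bubble, norm_smul, norm_sub_rev]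
  rw [this, smul_eq_mul]
  field_simp

/-- Dilation preserves the mass of the bubble, so the bound is uniform in m and y, as dominated
convergence requires. -/
lemma abs_integral_bubble_mul_le {φ : E → ℝ} {S : ℝ} (hS : ∀ x, |φ x| ≤ S) {m : ℝ} (hm : 0 < m)
    (y : E) : |∫ x, m ^ Module.finrank ℝ E * bubble E (m • (x - y)) * φ x ∂ν|
      ≤ (∫ x, bubble E x ∂ν) * S := by
  have hi : Integrable (fun x => m ^ Module.finrank ℝ E * bubble E (m • (x - y))) ν :=
    (((integrable_comp_smul_iff ν (bubble E) hm.ne').2 integrable_bubble).comp_sub_right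
      y).const_mul _
  have hint : ∫ x, m ^ Module.finrank ℝ E * bubble E (m • (x - y)) ∂ν = ∫ x, bubble E x ∂ν := by
    rw [integral_const_mul, integral_sub_right_eq_self (fun x => bubble E (m • x)) y,
      Measure.integral_comp_smul, smul_eq_mul, abs_of_pos (by positivity), ← mul_assoc,
      mul_inv_cancel₀ (by positivity), one_mul]
  rw [← hint, ← integral_mul_const, ← Real.norm_eq_abs]
  refine norm_integral_le_of_norm_le (hi.mul_const S) (ae_of_all _ fun x => ?_)
  rw [norm_mul, Real.norm_of_nonneg (mul_nonneg (by positivity) (bubble_nonneg _))]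
  exact mul_le_mul_of_nonneg_left (hS x) (mul_nonneg (by positivity) (bubble_nonneg _))

/-- Testing the regularized Green function against a Laplacian. -/
lemma integral_greenKernel_mul_laplacian {φ : E → ℝ} (hφ : ContDiff ℝ 2 φ)
    (hc : HasCompactSupport φ) {m : ℝ} (hm : 0 < m) (y : E) :
    ∫ x, greenKernel (Module.finrank ℝ E / 2 : ℝ) (m ^ 2)⁻¹ x y * Laplacian.laplacian φ x ∂ν
      = ∫ x, m ^ Module.finrank ℝ E * bubble E (m • (x - y)) * φ x ∂ν
        - ∫ x, 2 * Module.finrank ℝ E * ‖y‖ ^ 2 * (m ^ 2)⁻¹ *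
          (quad (‖y‖ ^ 2) 1 y x + (m ^ 2)⁻¹) ^ (-(Module.finrank ℝ E / 2 : ℝ) - 1) * φ x ∂ν := by
  set p : ℝ := Module.finrank ℝ E / 2 with hp
  have ht : 0 < (m ^ 2)⁻¹ := by positivity
  have hq1 : ∀ x : E, 0 < quad 1 (‖y‖ ^ 2) y x + (m ^ 2)⁻¹ := fun x => by
    linarith [quad_one_nonneg x y]
  have hq2 : ∀ x : E, 0 < quad (‖y‖ ^ 2) 1 y x + (m ^ 2)⁻¹ := fun x => by
    linarith [quad_kelvin_nonneg x y]
  have hF1 := contDiff_powerPrimitive_quad p hq1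
  have hF2 := contDiff_powerPrimitive_quad p hq2
  have hΔ : HasCompactSupport (Laplacian.laplacian φ) :=
    hc.of_isClosed_subset (isClosed_tsupport _) (tsupport_laplacian_subset hφ)
  have hΔc := continuous_laplacian hφ
  simp only [greenKernel, sub_mul]
  have hi : ∀ F : E → ℝ, Continuous F → Integrable (fun x => F x * Laplacian.laplacian φ x) ν :=
    fun F hF => (hF.mul hΔc).integrable_of_hasCompactSupport hΔ.mul_left
  rw [integral_sub (hi _ hF1.continuous) (hi _ hF2.continuous), integral_mul_laplacian hF1 hφ hc, integral_mul_laplacian hF2 hφ hc]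
  have hL1 := laplacian_powerPrimitive_quad (show ‖y‖ ^ 2 = 1 * ‖y‖ ^ 2 by ring) hq1
  have hL2 := laplacian_powerPrimitive_quad (show ‖y‖ ^ 2 = ‖y‖ ^ 2 * 1 by ring) hq2
  rw [← hp] at hL1 hL2
  simp_rw [hL1, hL2, quad_one_normSq, pow_mul_bubble_smul hm, mul_one, hp]

variable {μ : Measure E} [IsFiniteMeasure μ] {d : ℕ} {C : ENNReal} {ρ : ℝ} {g : E → ℝ}

/-- Fubini, justified by the boundedness of the kernel on the product of unit balls when t > 0. -/
lemma integral_greenPotential_mul_laplacian_of_pos {φ : E → ℝ} (hφ : ContDiff ℝ 2 φ)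
    (hc : HasCompactSupport φ) (hsupp : tsupport φ ⊆ Metric.ball 0 1) (p : ℝ) {t : ℝ}
    (ht : 0 < t) (hg : Integrable g μ) (hμ : ∀ᵐ y ∂μ, ‖y‖ ≤ 1) :
    ∫ x in Metric.ball 0 1, greenPotential p t μ g x * Laplacian.laplacian φ x ∂ν
      = ∫ y, g y * ∫ x, greenKernel p t x y * Laplacian.laplacian φ x ∂ν ∂μ := by
  obtain ⟨B, hB⟩ := exists_greenKernel_bound (E := E) p ht
  have hΔ : HasCompactSupport (Laplacian.laplacian φ) :=
    hc.of_isClosed_subset (isClosed_tsupport _) (tsupport_laplacian_subset hφ)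
  have hΔi : Integrable (Laplacian.laplacian φ) ν :=
    (continuous_laplacian hφ).integrable_of_hasCompactSupport hΔ
  have hprod : Integrable (Function.uncurry fun x y =>
      greenKernel p t x y * g y * Laplacian.laplacian φ x)
      ((ν.restrict (Metric.ball 0 1)).prod μ) := by
    have h1 : Integrable (fun z : E × E => Laplacian.laplacian φ z.1 * g z.2)
        ((ν.restrict (Metric.ball 0 1)).prod μ) := hΔi.restrict.mul_prod hg
    have h2 : ∀ᵐ z : E × E ∂((ν.restrict (Metric.ball 0 1)).prod μ),
        ‖greenKernel p t z.1 z.2‖ ≤ B := by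
      have hx : ∀ᵐ x ∂(ν.restrict (Metric.ball (0 : E) 1)), ‖x‖ ≤ 1 := by
        filter_upwards [ae_restrict_mem Metric.isOpen_ball.measurableSet] with x hx
        simpa using (mem_ball_zero_iff.1 hx).le
      filter_upwards [Measure.quasiMeasurePreserving_fst.ae hx,
        Measure.quasiMeasurePreserving_snd.ae hμ] with z h1 h2
      exact hB _ _ h1 h2
    refine (h1.bdd_mul (continuous_uncurry_greenKernel p ht).aestronglyMeasurable h2).congr
      (ae_of_all _ fun z => ?_)
    simp only [Function.uncurry]
    ring
  have hball : ∀ y, ∫ x, greenKernel p t x y * Laplacian.laplacian φ x ∂ν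
      = ∫ x in Metric.ball 0 1, greenKernel p t x y * Laplacian.laplacian φ x ∂ν := fun y => by
    refine (setIntegral_eq_integral_of_forall_compl_eq_zero fun x hx => ?_).symm
    rw [image_eq_zero_of_notMem_tsupport
      (fun h => hx (hsupp (tsupport_laplacian_subset hφ h))), mul_zero]
  calc _ = ∫ x in Metric.ball 0 1, ∫ y,
        greenKernel p t x y * g y * Laplacian.laplacian φ x ∂μ ∂ν := by
        simp_rw [greenPotential, integral_mul_const]
    _ = ∫ y, ∫ x in Metric.ball 0 1,
        greenKernel p t x y * g y * Laplacian.laplacian φ x ∂ν ∂μ := integral_integral_swap hprod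
    _ = _ := by
        congr 1
        funext y
        rw [hball, ← integral_const_mul]
        congr 1
        funext x
        ring

/-- The Green potential of `g dμ` solves the Poisson equation with right-hand side a multiple of
`g dμ`, in the sense of distributions on the unit ball. -/
lemma HasGrowth.integral_greenPotential_mul_laplacian (h : HasGrowth μ d C) (hd : d ≠ 0)
    (hC : C ≠ ⊤) (hE : Module.finrank ℝ E = d + 1) (hρ : ρ < 1) (hμ : ∀ᵐ y ∂μ, ‖y‖ ≤ ρ)
    (hg : MemLp g ⊤ μ) {φ : E → ℝ} (hφ : ContDiff ℝ 2 φ)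
    (hc : HasCompactSupport φ) (hsupp : tsupport φ ⊆ Metric.ball 0 1) :
    ∫ x in Metric.ball 0 1,
        greenPotential ((d + 1 : ℝ) / 2) 0 μ g x * Laplacian.laplacian φ x ∂ν
      = (∫ x, bubble E x ∂ν) * ∫ y, g y * φ y ∂μ := by
  have : Nontrivial E := Module.nontrivial_of_finrank_pos (R := ℝ) (by omega)
  have hdE : (d + 1 : ℝ) = Module.finrank ℝ E := by rw [hE]; push_cast; ring
  have hcont := h.continuousOn_greenPotential hd hC hρ hμ hg
  have hunif := h.tendstoUniformlyOn_greenPotential hd hC hρ hμ hg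
  rw [hdE] at hcont hunif ⊢
  set n := Module.finrank ℝ E with hn
  set p : ℝ := n / 2 with hp
  have hp0 : 0 ≤ p := by positivity
  have hgi : Integrable g μ := hg.integrable le_top
  have hμ1 : ∀ᵐ y ∂μ, ‖y‖ ≤ 1 := by filter_upwards [hμ] with y hy using hy.trans hρ.le
  have hΔ : HasCompactSupport (Laplacian.laplacian φ) :=
    hc.of_isClosed_subset (isClosed_tsupport _) (tsupport_laplacian_subset hφ)
  have hΔc := continuous_laplacian hφ
  obtain ⟨S, hS⟩ := hc.exists_bound_of_continuous hφ.continuous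
  have hS0 : 0 ≤ S := (norm_nonneg _).trans (hS 0)
  have ht : Tendsto (fun m : ℝ => (m ^ 2)⁻¹) atTop (𝓝[>] 0) :=
    (tendsto_inv_atTop_nhdsGT_zero).comp (tendsto_pow_atTop two_ne_zero)
  have hballm : MeasurableSet (Metric.ball (0 : E) 1) := Metric.isOpen_ball.measurableSet
  -- convergence of the left-hand sides
  have hleft : Tendsto (fun m : ℝ => ∫ x in Metric.ball 0 1,
      greenPotential p (m ^ 2)⁻¹ μ g x * Laplacian.laplacian φ x ∂ν) atTop
      (𝓝 (∫ x in Metric.ball 0 1,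
        greenPotential p 0 μ g x * Laplacian.laplacian φ x ∂ν)) := by
    obtain ⟨B, hB⟩ := (isCompact_closedBall (0 : E) 1).exists_bound_of_continuousOn hcont
    refine tendsto_integral_filter_of_dominated_convergence
      (bound := fun x => (B + 1) * |Laplacian.laplacian φ x|) ?_ ?_ ?_ ?_
    · filter_upwards [eventually_gt_atTop 0] with m hm
      exact ((continuousOn_greenPotential_of_pos p (by positivity) hgi hμ1).mono
        Metric.ball_subset_closedBall).aestronglyMeasurable hballm |>.mul
        hΔc.aestronglyMeasurable
    -- Eventually the regularized potential is within 1 of its limit, which is bounded by B.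
    · filter_upwards [ht.eventually ((Metric.tendstoUniformlyOn_iff.1 hunif) 1 one_pos)] with m hm
      filter_upwards [ae_restrict_mem hballm] with x hx
      have hx' := Metric.ball_subset_closedBall hx
      rw [norm_mul]
      refine mul_le_mul_of_nonneg_right ?_ (abs_nonneg _)
      have h1 := hm x hx'
      have h2 := hB x hx'
      rw [dist_comm, dist_eq_norm] at h1
      have h3 := norm_le_norm_add_norm_sub' (greenPotential p (m ^ 2)⁻¹ μ g x)
        (greenPotential p 0 μ g x)
      linarith
    · exact (((hΔc.integrable_of_hasCompactSupport hΔ).abs).const_mul _).restrict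
    · filter_upwards [ae_restrict_mem hballm] with x hx
      exact ((hunif.tendsto_at (Metric.ball_subset_closedBall hx)).comp ht).mul_const _
  -- convergence of the right-hand sides
  set κ : ℝ := (1 - ρ) ^ 2 with hκ
  have hκ0 : 0 < κ := by have : 0 < 1 - ρ := by linarith
                         positivity
  set c := ∫ x, bubble E x ∂ν with hcdef
  -- The contribution of the Kelvin term. On the support of φ its denominator is bounded below by a
  -- power of κ, so it is O(m⁻²) uniformly for ‖y‖ ≤ ρ.
  set K : ℝ → E → ℝ := fun m y => ∫ x, 2 * n * ‖y‖ ^ 2 * (m ^ 2)⁻¹ *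
    (quad (‖y‖ ^ 2) 1 y x + (m ^ 2)⁻¹) ^ (-p - 1) * φ x ∂ν with hK
  set L : ℝ := 2 * n * κ ^ (-p - 1) * S * ν.real (Metric.ball 0 1) with hL
  have hL0 : 0 ≤ L := by positivity
  have hKbound : ∀ m : ℝ, 0 < m → ∀ y : E, ‖y‖ ≤ ρ → |K m y| ≤ (m ^ 2)⁻¹ * L := by
    intro m hm y hy
    have h0 : K m y = ∫ x in Metric.ball 0 1, 2 * n * ‖y‖ ^ 2 * (m ^ 2)⁻¹ *
        (quad (‖y‖ ^ 2) 1 y x + (m ^ 2)⁻¹) ^ (-p - 1) * φ x ∂ν := by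
      refine (setIntegral_eq_integral_of_forall_compl_eq_zero fun x hx => ?_).symm
      rw [image_eq_zero_of_notMem_tsupport (fun h => hx (hsupp h)), mul_zero]
    rw [h0, ← Real.norm_eq_abs]
    have hb := norm_setIntegral_le_of_norm_le_const (μ := ν) (s := Metric.ball (0 : E) 1)
      (C := (m ^ 2)⁻¹ * (2 * n * κ ^ (-p - 1) * S))
      (f := fun x => 2 * n * ‖y‖ ^ 2 * (m ^ 2)⁻¹ *
        (quad (‖y‖ ^ 2) 1 y x + (m ^ 2)⁻¹) ^ (-p - 1) * φ x) measure_ball_lt_top ?_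
    · refine hb.trans (le_of_eq ?_)
      rw [hL]; ring
    · intro x hx
      have hq : κ ≤ quad (‖y‖ ^ 2) 1 y x :=
        quad_kelvin_ge hρ (by simpa using (mem_ball_zero_iff.1 hx).le) hy
      have hm2 : 0 < (m ^ 2)⁻¹ := by positivity
      have h2 : (quad (‖y‖ ^ 2) 1 y x + (m ^ 2)⁻¹) ^ (-p - 1) ≤ κ ^ (-p - 1) :=
        Real.rpow_le_rpow_of_nonpos hκ0 (by linarith) (by linarith)
      have h3 : 0 ≤ (quad (‖y‖ ^ 2) 1 y x + (m ^ 2)⁻¹) ^ (-p - 1) :=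
        Real.rpow_nonneg (by linarith) _
      have h4 : ‖y‖ ^ 2 ≤ 1 := pow_le_one₀ (norm_nonneg _) (hy.trans hρ.le)
      rw [norm_mul, Real.norm_of_nonneg (by positivity)]
      calc _ ≤ 2 * n * 1 * (m ^ 2)⁻¹ * κ ^ (-p - 1) * S := by
            gcongr
            exact hS x
        _ = _ := by ring
  have hright : Tendsto (fun m : ℝ => ∫ y, g y * ∫ x, greenKernel p (m ^ 2)⁻¹ x y *
      Laplacian.laplacian φ x ∂ν ∂μ) atTop (𝓝 (∫ y, g y * (c * φ y) ∂μ)) := by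
    refine tendsto_integral_filter_of_dominated_convergence
      (bound := fun y => |g y| * (c * S + L)) ?_ ?_ ?_ ?_
    · filter_upwards [eventually_gt_atTop 0] with m hm
      refine hg.1.mul ?_
      have hcu := continuous_uncurry_greenKernel (E := E) p (show 0 < (m ^ 2)⁻¹ by positivity)
      have : StronglyMeasurable fun z : E × E =>
          greenKernel p (m ^ 2)⁻¹ z.2 z.1 * Laplacian.laplacian φ z.2 :=
        Continuous.stronglyMeasurable
          ((hcu.comp continuous_swap).mul (hΔc.comp continuous_snd))
      exact this.integral_prod_right.aestronglyMeasurable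
    · filter_upwards [eventually_ge_atTop 1] with m hm
      filter_upwards [hμ] with y hy
      have hm0 : 0 < m := by linarith
      rw [integral_greenKernel_mul_laplacian hφ hc hm0, norm_mul]
      refine mul_le_mul_of_nonneg_left ?_ (abs_nonneg _)
      refine (norm_sub_le _ _).trans (add_le_add (abs_integral_bubble_mul_le hS hm0 y) ?_)
      refine (hKbound m hm0 y hy).trans ?_
      have : (m ^ 2)⁻¹ ≤ 1 := inv_le_one_of_one_le₀ (one_le_pow₀ hm)
      nlinarith
    · exact hgi.abs.mul_const _
    · filter_upwards [hμ] with y hy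
      refine Tendsto.const_mul _ ?_
      have hK0 : Tendsto (fun m => K m y) atTop (𝓝 0) := by
        have h1 : Tendsto (fun m : ℝ => (m ^ 2)⁻¹ * L) atTop (𝓝 0) := by
          simpa using (ht.mono_right nhdsWithin_le_nhds).mul_const L
        refine squeeze_zero_norm' ?_ h1
        filter_upwards [eventually_gt_atTop 0] with m hm using hKbound m hm y hy
      have h2 := (tendsto_integral_bubble_mul (ν := ν) hφ.continuous hc y).sub hK0
      rw [sub_zero] at h2
      refine h2.congr' ?_
      filter_upwards [eventually_gt_atTop 0] with m hm
      exact (integral_greenKernel_mul_laplacian hφ hc hm y).symm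
  have heq : (fun m : ℝ => ∫ x in Metric.ball 0 1,
      greenPotential p (m ^ 2)⁻¹ μ g x * Laplacian.laplacian φ x ∂ν) =ᶠ[atTop]
      fun m : ℝ => ∫ y, g y * ∫ x, greenKernel p (m ^ 2)⁻¹ x y *
        Laplacian.laplacian φ x ∂ν ∂μ := by
    filter_upwards [eventually_gt_atTop 0] with m hm
    exact integral_greenPotential_mul_laplacian_of_pos hφ hc hsupp p (by positivity) hgi hμ1
  rw [tendsto_nhds_unique hleft (hright.congr' heq.symm), ← integral_const_mul]
  congr 1
  funext y
  ring

end PoissonEquation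

/-! ### Differentiating the potential off the hypersurface. -/

section Gradient

variable {E : Type*} [NormedAddCommGroup E] [InnerProductSpace ℝ E]

/-- The derivative of `greenKernel p 0 x y` with respect to `x`. -/
noncomputable def greenKernelDeriv (p : ℝ) (x y : E) : E →L[ℝ] ℝ :=
  (2 * ‖x - y‖ ^ (-2 * p)) • innerSL ℝ (x - y)
    - (2 * quad (‖y‖ ^ 2) 1 y x ^ (-p)) • innerSL ℝ (‖y‖ ^ 2 • x - y)

lemma norm_rpow_neg_two_mul {E : Type*} [SeminormedAddCommGroup E] (p : ℝ) (z : E) :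
    ‖z‖ ^ (-2 * p) = (‖z‖ ^ 2) ^ (-p) := by
  rw [← Real.rpow_natCast, ← Real.rpow_mul (norm_nonneg _)]
  norm_num

lemma hasFDerivAt_greenKernel (p : ℝ) {x y : E} (hxy : x ≠ y)
    (hq : 0 < quad (‖y‖ ^ 2) 1 y x) :
    HasFDerivAt (fun z => greenKernel p 0 z y) (greenKernelDeriv p x y) x := by
  have h0 : 0 < quad 1 (‖y‖ ^ 2) y x := by
    rw [quad_one_normSq]
    have : 0 < ‖x - y‖ := norm_pos_iff.2 (sub_ne_zero.2 hxy)
    positivity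
  have h1 := hasFDerivAt_powerPrimitive_quad p (t := 0) (by simpa using h0)
  have h2 := hasFDerivAt_powerPrimitive_quad p (t := 0) (by simpa using hq)
  refine (h1.sub h2).congr_fderiv ?_
  rw [greenKernelDeriv, norm_rpow_neg_two_mul]
  simp only [add_zero, one_smul, quad_one_normSq]

lemma norm_greenKernelDeriv_le {p δ κ : ℝ} (hp : 0 ≤ p) (hδ : 0 < δ) (hκ : 0 < κ) {x y : E}
    (hx : ‖x‖ ≤ 1) (hy : ‖y‖ ≤ 1) (hxy : δ ≤ ‖x - y‖) (hq : κ ≤ quad (‖y‖ ^ 2) 1 y x) :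
    ‖greenKernelDeriv p x y‖ ≤ 2 * δ ^ (-2 * p) * 2 + 2 * κ ^ (-p) * 2 := by
  have h1 : ‖x - y‖ ^ (-2 * p) ≤ δ ^ (-2 * p) :=
    Real.rpow_le_rpow_of_nonpos hδ hxy (by linarith)
  have h2 : quad (‖y‖ ^ 2) 1 y x ^ (-p) ≤ κ ^ (-p) :=
    Real.rpow_le_rpow_of_nonpos hκ hq (by linarith)
  have h3 : ‖x - y‖ ≤ 2 := (norm_sub_le _ _).trans (by linarith)
  have h4 : ‖‖y‖ ^ 2 • x - y‖ ≤ 2 := by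
    refine (norm_sub_le _ _).trans ?_
    rw [norm_smul, norm_pow, norm_norm]
    have : ‖y‖ ^ 2 ≤ 1 := pow_le_one₀ (norm_nonneg _) hy
    nlinarith [norm_nonneg x, norm_nonneg y]
  have h5 : 0 ≤ quad (‖y‖ ^ 2) 1 y x ^ (-p) := Real.rpow_nonneg (hκ.le.trans hq) _
  refine (norm_sub_le _ _).trans ?_
  rw [norm_smul, norm_smul, innerSL_apply_norm, innerSL_apply_norm,
    Real.norm_of_nonneg (by positivity), Real.norm_of_nonneg (by positivity)]
  gcongr

variable [FiniteDimensional ℝ E] [MeasurableSpace E] [BorelSpace E] {μ : Measure E}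
  {ρ : ℝ} {g : E → ℝ}

/-- Differentiation of the Green potential away from the support of `μ`. -/
lemma hasFDerivAt_greenPotential {p : ℝ} (hp : 0 ≤ p) (hρ : ρ < 1) (hμ : ∀ᵐ y ∂μ, ‖y‖ ≤ ρ)
    (hg : Integrable g μ) {x₀ : E} (hx₀ : ‖x₀‖ < 1) {δ : ℝ} (hδ : 0 < δ)
    (hsep : ∀ᵐ y ∂μ, δ ≤ ‖x₀ - y‖) :
    Integrable (fun y => g y • greenKernelDeriv p x₀ y) μ ∧
    HasFDerivAt (greenPotential p 0 μ g) (∫ y, g y • greenKernelDeriv p x₀ y ∂μ) x₀ := by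
  set κ : ℝ := (1 - ρ) ^ 2 with hκ
  have hκ0 : 0 < κ := by have : 0 < 1 - ρ := by linarith
                         positivity
  set S : Set E := {y | ‖y‖ ≤ ρ ∧ δ ≤ ‖x₀ - y‖} with hS
  have hSc : IsClosed S :=
    (isClosed_le (f := fun y : E => ‖y‖) continuous_norm continuous_const).inter
      (isClosed_le (g := fun y : E => ‖x₀ - y‖) continuous_const (by fun_prop))
  have hSμ : ∀ᵐ y ∂μ, y ∈ S := by
    filter_upwards [hμ, hsep] with y h1 h2 using ⟨h1, h2⟩
  -- Within r of x₀ the points stay in the unit ball and at distance at least δ/2 from S, so the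
  -- derivatives of the kernel have a common bound.
  set r : ℝ := min (δ / 2) (1 - ‖x₀‖) with hr
  have hr0 : 0 < r := lt_min (by positivity) (by linarith)
  have hball : ∀ x ∈ Metric.ball x₀ r, ‖x‖ ≤ 1 ∧ ∀ y ∈ S, δ / 2 ≤ ‖x - y‖ := by
    intro x hx
    rw [Metric.mem_ball, dist_eq_norm] at hx
    refine ⟨?_, fun y hy => ?_⟩
    · have h1 := norm_le_norm_add_norm_sub' x x₀
      have h2 := hx.trans_le (min_le_right _ _)
      linarith
    · have h1 : ‖x₀ - y‖ ≤ ‖x₀ - x‖ + ‖x - y‖ := norm_sub_le_norm_sub_add_norm_sub _ _ _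
      have h2 := hx.trans_le (min_le_left _ _)
      rw [norm_sub_rev] at h2
      linarith [hy.2]
  have hq : ∀ x, ‖x‖ ≤ 1 → ∀ y ∈ S, κ ≤ quad (‖y‖ ^ 2) 1 y x := fun x hx y hy =>
    quad_kelvin_ge hρ hx hy.1
  have hqc : ∀ x : E, Continuous fun y : E => quad (‖y‖ ^ 2) 1 y x := fun x => by
    simp only [quad]; fun_prop
  have hmeas : ∀ x ∈ Metric.ball x₀ r,
      AEStronglyMeasurable (fun y => greenKernel p 0 x y * g y) μ := by
    intro x hx
    refine AEStronglyMeasurable.mul ?_ hg.1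
    rw [← Measure.restrict_eq_self_of_ae_mem hSμ]
    refine ContinuousOn.aestronglyMeasurable ?_ hSc.measurableSet
    change ContinuousOn (fun y => greenKernel p 0 x y) S
    simp only [greenKernel, add_zero, quad_one_normSq]
    refine ((continuousOn_powerPrimitive p).comp (by fun_prop) fun y hy => ?_).sub
      ((continuousOn_powerPrimitive p).comp (hqc x).continuousOn
        fun y hy => hκ0.trans_le (hq x (hball x hx).1 y hy))
    have := (hball x hx).2 y hy
    have h2 : 0 < ‖x - y‖ := by linarith
    exact mem_Ioi.2 (by positivity)
  have hx₀r : x₀ ∈ Metric.ball x₀ r := Metric.mem_ball_self hr0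
  have hmeas' : AEStronglyMeasurable (fun y => g y • greenKernelDeriv p x₀ y) μ := by
    refine hg.1.smul ?_
    rw [← Measure.restrict_eq_self_of_ae_mem hSμ]
    refine ContinuousOn.aestronglyMeasurable ?_ hSc.measurableSet
    change ContinuousOn (fun y => greenKernelDeriv p x₀ y) S
    have hc1 : ContinuousOn (fun y => 2 * ‖x₀ - y‖ ^ (-2 * p)) S :=
      continuousOn_const.mul (ContinuousOn.rpow_const (by fun_prop)
        fun y hy => Or.inl (hδ.trans_le hy.2).ne')
    have hc2 : ContinuousOn (fun y => 2 * quad (‖y‖ ^ 2) 1 y x₀ ^ (-p)) S :=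
      continuousOn_const.mul ((hqc x₀).continuousOn.rpow_const
        fun y hy => Or.inl (hκ0.trans_le (hq x₀ hx₀.le y hy)).ne')
    have hd1 : Continuous fun y : E => innerSL ℝ (x₀ - y) :=
      (innerSL ℝ).continuous.comp (by fun_prop)
    have hd2 : Continuous fun y : E => innerSL ℝ (‖y‖ ^ 2 • x₀ - y) :=
      (innerSL ℝ).continuous.comp (by fun_prop)
    exact (hc1.smul hd1.continuousOn).sub (hc2.smul hd2.continuousOn)
  set B : ℝ := 2 * (δ / 2) ^ (-2 * p) * 2 + 2 * κ ^ (-p) * 2 with hB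
  have hbound : ∀ y ∈ S, ∀ x ∈ Metric.ball x₀ r, ‖g y • greenKernelDeriv p x y‖ ≤ |g y| * B := by
    intro y hy x hx
    rw [norm_smul]
    exact mul_le_mul_of_nonneg_left (norm_greenKernelDeriv_le hp (by positivity) hκ0
      (hball x hx).1 (hy.1.trans hρ.le) ((hball x hx).2 y hy) (hq x (hball x hx).1 y hy))
      (abs_nonneg _)
  have hi' : Integrable (fun y => g y • greenKernelDeriv p x₀ y) μ := by
    refine Integrable.mono' (hg.abs.mul_const B) hmeas' ?_
    filter_upwards [hSμ] with y hy using hbound y hy x₀ hx₀r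
  refine ⟨hi', ?_⟩
  refine hasFDerivAt_integral_of_dominated_of_fderiv_le (bound := fun y => |g y| * B)
    (F' := fun x y => g y • greenKernelDeriv p x y)
    (Metric.ball_mem_nhds x₀ hr0) ?_ ?_ hmeas' ?_ (hg.abs.mul_const B) ?_
  · filter_upwards [Metric.ball_mem_nhds x₀ hr0] with x hx using hmeas x hx
  · obtain ⟨D, hD⟩ : ∃ D, ∀ y ∈ S, ‖greenKernel p 0 x₀ y‖ ≤ D := by
      have hScomp : IsCompact S := (isCompact_closedBall (0 : E) ρ).of_isClosed_subset hSc
        fun y hy => by simpa using hy.1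
      refine hScomp.exists_bound_of_continuousOn (f := fun y => greenKernel p 0 x₀ y) ?_
      simp only [greenKernel, add_zero, quad_one_normSq]
      refine ((continuousOn_powerPrimitive p).comp (by fun_prop) fun y hy => ?_).sub
        ((continuousOn_powerPrimitive p).comp (hqc x₀).continuousOn
          fun y hy => hκ0.trans_le (hq x₀ hx₀.le y hy))
      have h2 : 0 < ‖x₀ - y‖ := hδ.trans_le hy.2
      exact mem_Ioi.2 (by positivity)
    refine Integrable.mono' (hg.abs.const_mul D) (hmeas x₀ hx₀r) ?_
    filter_upwards [hSμ] with y hy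
    rw [norm_mul]
    exact mul_le_mul_of_nonneg_right (hD y hy) (abs_nonneg _)
  · filter_upwards [hSμ] with y hy using hbound y hy
  · filter_upwards [hSμ] with y hy x hx
    have h1 := (hball x hx).2 y hy
    have hne : x ≠ y := by
      rintro rfl
      simp at h1
      linarith
    exact (hasFDerivAt_greenKernel p hne (hκ0.trans_le (hq x (hball x hx).1 y hy))).mul_const _

end Gradient

/-! ### Divergence of the singular integral by dyadic decomposition. -/

section Divergence

open scoped Pointwise

variable {E : Type*} [NormedAddCommGroup E] [InnerProductSpace ℝ E]

/-- A dyadic piece, of size `s`, of the half hyperplane `{⟪e, x⟫ = 0, ⟪v, x⟫ > 0}`. -/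
def hyperplanePiece (e v : E) (s : ℝ) : Set E :=
  {x | inner ℝ e x = 0 ∧ ‖x‖ < s ∧ s / 2 < inner ℝ v x}

lemma smul_hyperplanePiece (e v : E) {s : ℝ} (hs : 0 < s) :
    hyperplanePiece e v s = s • hyperplanePiece e v 1 := by
  ext x
  rw [mem_smul_set_iff_inv_smul_mem₀ hs.ne']
  simp only [hyperplanePiece, mem_ofPred_eq, inner_smul_right, norm_smul, norm_inv,
    Real.norm_of_nonneg hs.le]
  rw [inv_mul_lt_iff₀ hs, mul_one, lt_inv_mul_iff₀ hs, mul_eq_zero]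
  simp [hs.ne', div_eq_mul_inv]

variable [FiniteDimensional ℝ E] [MeasurableSpace E] [BorelSpace E] {d : ℕ}

lemma measurableSet_hyperplanePiece (e v : E) (s : ℝ) : MeasurableSet (hyperplanePiece e v s) :=
  (measurableSet_eq_fun (f := fun x => inner ℝ e x) (by fun_prop) measurable_const).inter
    ((measurableSet_lt measurable_norm measurable_const).inter
      (measurableSet_lt (g := fun x => inner ℝ v x) measurable_const (by fun_prop)))

/-- The unit piece is a nonempty bounded open subset of the hyperplane, hence of positive finite
measure V; the others are its dilations. -/
lemma exists_measure_hyperplanePiece (hE : Module.finrank ℝ E = d + 1) {e v : E}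
    (he : ‖e‖ = 1) (hv : ‖v‖ = 1) (hev : inner ℝ e v = 0) :
    ∃ V > 0, ∀ s : ℝ, 0 < s →
      μHE[d] (hyperplanePiece e v s) = ENNReal.ofReal (s ^ d * V) := by
  have he0 : e ≠ 0 := by rintro rfl; simp at he
  have : Fact (Module.finrank ℝ E = d + 1) := ⟨hE⟩
  have hH : Module.finrank ℝ (ℝ ∙ e)ᗮ = d := Submodule.finrank_orthogonal_span_singleton he0
  set H : Submodule ℝ E := (ℝ ∙ e)ᗮ with hHdef
  have hmem : ∀ x, x ∈ H ↔ inner ℝ e x = 0 := fun x => by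
    rw [hHdef, Submodule.mem_orthogonal_singleton_iff_inner_right]
  set U : Set H := {z | ‖(z : E)‖ < 1 ∧ 1 / 2 < inner ℝ v (z : E)} with hU
  have hUo : IsOpen U :=
    (isOpen_lt (f := fun z : H => ‖(z : E)‖) (by fun_prop) continuous_const).inter
      (isOpen_lt (g := fun z : H => inner ℝ v (z : E)) continuous_const (by fun_prop))
  have hUne : U.Nonempty := by
    refine ⟨⟨(3 / 4 : ℝ) • v, (hmem _).2 (by rw [inner_smul_right, hev, mul_zero])⟩, ?_, ?_⟩
    · simp only [norm_smul, hv]; norm_num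
    · simp only [inner_smul_right, real_inner_self_eq_norm_sq, hv]; norm_num
  have himg : hyperplanePiece e v 1 = H.subtypeₗᵢ '' U := by
    ext x
    simp only [hyperplanePiece, mem_ofPred_eq, mem_image, hU]
    exact ⟨fun hx => ⟨⟨x, (hmem x).2 hx.1⟩, hx.2, rfl⟩,
      by rintro ⟨z, hz, rfl⟩; exact ⟨(hmem _).1 z.2, hz⟩⟩
  have h1 : μHE[d] (hyperplanePiece e v 1) = μHE[Module.finrank ℝ H] U := by
    rw [himg, H.subtypeₗᵢ.isometry.euclideanHausdorffMeasure_image, hH]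
  have hpos : 0 < μHE[Module.finrank ℝ H] U := hUo.measure_pos _ hUne
  have hfin : μHE[Module.finrank ℝ H] U < ⊤ := by
    refine lt_of_le_of_lt (measure_mono (t := Metric.ball 0 1) fun z hz => ?_)
      measure_ball_lt_top
    simpa using hz.1
  refine ⟨(μHE[Module.finrank ℝ H] U).toReal, ENNReal.toReal_pos hpos.ne' hfin.ne,
    fun s hs => ?_⟩
  rw [smul_hyperplanePiece e v hs, Measure.euclideanHausdorffMeasure_smul₀ d hs.ne', h1,
    ENNReal.ofReal_mul (by positivity), ENNReal.ofReal_toReal hfin.ne, ENNReal.smul_def,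
    smul_eq_mul, ENNReal.ofReal_pow hs.le]
  congr 1
  rw [ENNReal.coe_pow]
  congr 1
  rw [ENNReal.ofReal, Real.toNNReal_of_nonneg hs.le]
  congr 1
  ext
  simp [abs_of_pos hs]

/-- The sign that prevents cancellation: the integral over A is at least the integral over the
dyadic pieces. -/
lemma logProfile_mul_self_nonneg (t : ℝ) : 0 ≤ logProfile t * t := by
  unfold logProfile
  split_ifs with h
  · positivity
  · simp

/-- From t > 2^(-(k+2)) follows |log t| ≤ (k + 2) log 2: on a logarithmic scale the profile decays
only like 1/k. -/
lemma le_logProfile_mul_self {k : ℕ} {t : ℝ} (h1 : (1 / 2 : ℝ) ^ (k + 1) / 2 < t)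
    (h2 : t < (1 / 2) ^ (k + 1)) :
    1 / ((k + 2) * Real.log 2) * ((1 / 2) ^ (k + 1) / 2) ≤ logProfile t * t := by
  have ht : 0 < t := lt_trans (by positivity) h1
  have hlog2 : 0 < Real.log 2 := Real.log_pos (by norm_num)
  have h3 : (1 / 2 : ℝ) ^ (k + 1) / 2 = (1 / 2) ^ (k + 2) := by ring
  have h4 : Real.log ((1 / 2 : ℝ) ^ (k + 2)) = -((k + 2) * Real.log 2) := by
    rw [Real.log_pow, one_div, Real.log_inv]
    push_cast
    ring
  have h5 : -((k + 2) * Real.log 2) < Real.log t := by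
    rw [← h4, ← h3]
    exact Real.log_lt_log (by positivity) h1
  have h6 : Real.log t < 0 := Real.log_neg ht (h2.trans_le (pow_le_one₀ (by norm_num) (by norm_num)))
  rw [logProfile, if_pos ht]
  refine mul_le_mul ?_ h1.le (by positivity) (by positivity)
  refine one_div_le_one_div_of_le (abs_pos.2 h6.ne) ?_
  rw [abs_of_neg h6]
  linarith

/-- Divergence of the singular integral which produces the gradient blow-up. -/
lemma tendsto_setIntegral_logProfile_atTop (hE : Module.finrank ℝ E = d + 1) {e v : E}
    (he : ‖e‖ = 1) (hv : ‖v‖ = 1) (hev : inner ℝ e v = 0) {A : Set E}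
    (hA : {x | inner ℝ e x = 0} ∩ Metric.ball 0 (1 / 2) ⊆ A)
    (hint : ∀ ε : ℝ, 0 < ε → IntegrableOn (fun y => logProfile (inner ℝ v y) * inner ℝ v y *
      (‖y‖ ^ 2 + ε ^ 2) ^ (-((d + 1 : ℝ) / 2))) A μHE[d]) :
    Tendsto (fun ε : ℝ => ∫ y in A, logProfile (inner ℝ v y) * inner ℝ v y *
      (‖y‖ ^ 2 + ε ^ 2) ^ (-((d + 1 : ℝ) / 2)) ∂μHE[d]) (𝓝[>] 0) atTop := by
  obtain ⟨V, hV, hVs⟩ := exists_measure_hyperplanePiece hE he hv hev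
  set p : ℝ := (d + 1 : ℝ) / 2 with hp
  have hlog2 : 0 < Real.log 2 := Real.log_pos (by norm_num)
  -- The factor 4 comes from the bound s/2 for the height and from k + 2 ≤ 2(k + 1).
  set c : ℝ := V * (2 : ℝ) ^ (-p) / (4 * Real.log 2) with hc
  have hc0 : 0 < c := by positivity
  set P : ℕ → Set E := fun k => hyperplanePiece e v ((1 / 2) ^ (k + 1)) with hP
  set h : ℝ → E → ℝ := fun ε y => logProfile (inner ℝ v y) * inner ℝ v y *
      (‖y‖ ^ 2 + ε ^ 2) ^ (-p) with hh
  have hnonneg : ∀ ε y, 0 ≤ h ε y := fun ε y =>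
    mul_nonneg (logProfile_mul_self_nonneg _) (by positivity)
  have hPA : ∀ k, P k ⊆ A := fun k x hx => hA ⟨hx.1, by
    rw [mem_ball_zero_iff]
    refine hx.2.1.trans_le ?_
    rw [pow_succ]
    have : (1 / 2 : ℝ) ^ k ≤ 1 := pow_le_one₀ (by norm_num) (by norm_num)
    linarith⟩
  have hinner : ∀ k, ∀ x ∈ P k, (1 / 2 : ℝ) ^ (k + 1) / 2 < inner ℝ v x ∧
      inner ℝ v x < (1 / 2) ^ (k + 1) := fun k x hx => by
    refine ⟨hx.2.2, lt_of_le_of_lt (real_inner_le_norm v x) ?_⟩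
    rw [hv, one_mul]; exact hx.2.1
  have hdisj : ∀ i j, i < j → Disjoint (P i) (P j) := by
    intro i j hij
    refine disjoint_left.2 fun x hi hj => ?_
    have h1 := (hinner i x hi).1
    have h2 := (hinner j x hj).2
    have h3 : (1 / 2 : ℝ) ^ (j + 1) ≤ (1 / 2) ^ (i + 1 + 1) :=
      pow_le_pow_of_le_one (by norm_num) (by norm_num) (by omega)
    rw [pow_succ _ (i + 1)] at h3
    linarith
  -- With s the size of the piece and ε ≤ s, one has ‖y‖² + ε² ≤ 2s². The powers s (height),
  -- s^(-(d+1)) (kernel) and s^d (area) cancel, leaving a multiple of 1/(k + 2).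
  have hpiece : ∀ k : ℕ, ∀ ε : ℝ, 0 < ε → ε ≤ (1 / 2) ^ (k + 1) →
      c * (1 / ((k : ℝ) + 1)) ≤ ∫ y in P k, h ε y ∂μHE[d] := by
    intro k ε hε hεk
    set s : ℝ := (1 / 2) ^ (k + 1) with hs
    have hs0 : 0 < s := by positivity
    have hμP : μHE[d].real (P k) = s ^ d * V := by
      rw [Measure.real, hP, hVs s hs0, ENNReal.toReal_ofReal (by positivity)]
    have hlow : ∀ y ∈ P k, 1 / ((k + 2) * Real.log 2) * (s / 2) * (2 * s ^ 2) ^ (-p) ≤ h ε y := by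
      intro y hy
      have hys : ‖y‖ < s := hy.2.1
      refine mul_le_mul (le_logProfile_mul_self (hinner k y hy).1 (hinner k y hy).2) ?_
        (by positivity) (logProfile_mul_self_nonneg _)
      refine Real.rpow_le_rpow_of_nonpos (by positivity) ?_ (neg_nonpos.2 (by positivity))
      nlinarith [norm_nonneg y]
    have hge := setIntegral_ge_of_const_le_real (measurableSet_hyperplanePiece e v s)
      (μ := μHE[d]) (by rw [hVs s hs0]; exact ENNReal.ofReal_ne_top) hlow
      ((hint ε hε).mono_set (hPA k))
    refine le_trans ?_ hge
    change _ ≤ _ * μHE[d].real (P k)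
    rw [hμP, Real.mul_rpow (by norm_num) (by positivity)]
    have h5 : (s ^ 2) ^ (-p) = (s * s ^ d)⁻¹ := by
      rw [Real.rpow_neg (by positivity), ← Real.rpow_natCast s 2, ← Real.rpow_mul hs0.le, hp,
        show ((2 : ℕ) : ℝ) * ((d + 1 : ℝ) / 2) = ((d + 1 : ℕ) : ℝ) by push_cast; ring,
        Real.rpow_natCast, pow_succ']
    rw [h5, hc]
    have h6 : 1 / ((k + 2) * Real.log 2) * (s / 2) * ((2 : ℝ) ^ (-p) * (s * s ^ d)⁻¹) * (s ^ d * V)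
        = V * 2 ^ (-p) / (2 * Real.log 2) * (1 / (k + 2)) := by
      field_simp
    have h7 : V * (2 : ℝ) ^ (-p) / (4 * Real.log 2) * (1 / ((k : ℝ) + 1))
        = V * 2 ^ (-p) / (2 * Real.log 2) * (1 / (2 * (k + 1))) := by
      field_simp
      ring
    rw [h6, h7]
    gcongr
    linarith [show (0 : ℝ) ≤ k by positivity]
  have hsum : ∀ N : ℕ, ∀ ε : ℝ, 0 < ε → ε ≤ (1 / 2) ^ N →
      c * ∑ k ∈ Finset.range N, 1 / ((k : ℝ) + 1) ≤ ∫ y in A, h ε y ∂μHE[d] := by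
    intro N ε hε hεN
    calc _ = ∑ k ∈ Finset.range N, c * (1 / ((k : ℝ) + 1)) := Finset.mul_sum _ _ _
      _ ≤ ∑ k ∈ Finset.range N, ∫ y in P k, h ε y ∂μHE[d] := by
        refine Finset.sum_le_sum fun k hk => hpiece k ε hε (hεN.trans ?_)
        exact pow_le_pow_of_le_one (by norm_num) (by norm_num) (Finset.mem_range.1 hk)
      _ = ∫ y in ⋃ k ∈ Finset.range N, P k, h ε y ∂μHE[d] := by
        refine (integral_biUnion_finset _ (fun k _ => measurableSet_hyperplanePiece e v _) ?_
          fun k _ => (hint ε hε).mono_set (hPA k)).symm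
        intro i _ j _ hij
        rcases lt_or_gt_of_ne hij with h' | h'
        · exact hdisj i j h'
        · exact (hdisj j i h').symm
      _ ≤ ∫ y in A, h ε y ∂μHE[d] :=
        setIntegral_mono_set (hint ε hε) (ae_of_all _ (hnonneg ε))
          (LE.le.eventuallyLE (iUnion₂_subset fun k _ => hPA k))
  rw [tendsto_atTop]
  intro b
  have hdiv := Real.tendsto_sum_range_one_div_nat_succ_atTop.const_mul_atTop hc0
  obtain ⟨N, hN⟩ := (tendsto_atTop.1 hdiv b).exists
  filter_upwards [Ioc_mem_nhdsGT (show (0 : ℝ) < (1 / 2) ^ N by positivity)] with ε hε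
  exact hN.trans (hsum N ε hε.1 hε.2)

end Divergence

/-! ### Blow-up of the tangential derivative and failure of the Lipschitz bound. -/

section Blowup

variable {E : Type*} [NormedAddCommGroup E] [InnerProductSpace ℝ E] {d : ℕ} {Γ : Set E} {e v : E} {g : E → ℝ} {ρ : ℝ}

lemma greenKernelDeriv_smul_apply (p : ℝ) (hev : inner ℝ e v = 0) (ε : ℝ) (y : E) :
    greenKernelDeriv p (ε • e) y v
      = 2 * quad (‖y‖ ^ 2) 1 y (ε • e) ^ (-p) * inner ℝ v y
        - 2 * (‖ε • e - y‖ ^ (-2 * p) * inner ℝ v y) := by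
  simp only [greenKernelDeriv, sub_apply, smul_apply, smul_eq_mul, innerSL_apply_apply,
    inner_sub_left, inner_smul_left, hev, real_inner_comm v y]
  simp
  ring

variable [FiniteDimensional ℝ E] [MeasurableSpace E] [BorelSpace E]

/-- Off the hypersurface, on the axis `e`, the potential is differentiable. -/
lemma hasFDerivAt_greenPotential_smul {p : ℝ} (hp : 0 ≤ p) (he : ‖e‖ = 1) (hΓc : IsClosed Γ)
    (hρ : ρ < 1) (hΓρ : ∀ y ∈ Γ, ‖y‖ ≤ ρ)
    (hflat : Γ ∩ Metric.ball 0 (1 / 2) = {x | inner ℝ e x = 0} ∩ Metric.ball 0 (1 / 2))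
    (hg : Integrable g (μHE[d].restrict Γ)) {ε : ℝ} (hε : ε ∈ Ioo (0 : ℝ) (1 / 2)) :
    Integrable (fun y => g y • greenKernelDeriv p (ε • e) y) (μHE[d].restrict Γ) ∧
    HasFDerivAt (greenPotential p 0 (μHE[d].restrict Γ) g)
      (∫ y in Γ, g y • greenKernelDeriv p (ε • e) y ∂μHE[d]) (ε • e) := by
  have hnorm : ‖ε • e‖ = ε := by rw [norm_smul, he, mul_one, Real.norm_of_nonneg hε.1.le]
  have hnot : ε • e ∉ Γ := fun hmem => by
    have h1 : ε • e ∈ Γ ∩ Metric.ball 0 (1 / 2) :=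
      ⟨hmem, mem_ball_zero_iff.2 (hnorm.trans_lt hε.2)⟩
    rw [hflat] at h1
    have h2 : inner ℝ e (ε • e) = 0 := h1.1
    rw [inner_smul_right, real_inner_self_eq_norm_sq, he] at h2
    linarith [hε.1]
  obtain ⟨δ, hδ, hδΓ⟩ := Metric.isOpen_iff.1 hΓc.isOpen_compl _ hnot
  refine hasFDerivAt_greenPotential hp hρ (ae_restrict_of_forall_mem hΓc.measurableSet hΓρ) hg
    (by rw [hnorm]; linarith [hε.2]) hδ (ae_restrict_of_forall_mem hΓc.measurableSet fun y hy => ?_)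
  by_contra! hlt
  refine hδΓ (a := y) ?_ hy
  rwa [Metric.mem_ball, dist_comm, dist_eq_norm]

/-- The tangential derivative of the potential of a density with a logarithmic profile blows up
along the normal axis. -/
lemma tendsto_fderiv_greenPotential_atBot (hE : Module.finrank ℝ E = d + 1)
    (he : ‖e‖ = 1) (hv : ‖v‖ = 1) (hev : inner ℝ e v = 0) (hΓc : IsClosed Γ)
    (hρ : ρ < 1) (hΓρ : ∀ y ∈ Γ, ‖y‖ ≤ ρ)
    (hflat : Γ ∩ Metric.ball 0 (1 / 2) = {x | inner ℝ e x = 0} ∩ Metric.ball 0 (1 / 2))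
    (hg : Integrable g (μHE[d].restrict Γ))
    (hgη : ∀ y ∈ Γ ∩ Metric.ball 0 (1 / 2), g y = logProfile (inner ℝ v y)) :
    Tendsto (fun ε : ℝ => fderiv ℝ (greenPotential ((d + 1 : ℝ) / 2) 0 (μHE[d].restrict Γ) g)
      (ε • e) v) (𝓝[>] 0) atBot := by
  set p : ℝ := (d + 1 : ℝ) / 2 with hp
  have hp0 : 0 ≤ p := by positivity
  set κ : ℝ := (1 - ρ) ^ 2 with hκ
  have hκ0 : 0 < κ := by have : 0 < 1 - ρ := by linarith
                         positivity
  set A : Set E := Γ ∩ Metric.ball 0 (1 / 2) with hA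
  have hAm : MeasurableSet A := hΓc.measurableSet.inter Metric.isOpen_ball.measurableSet
  set h : ℝ → E → ℝ := fun ε y => logProfile (inner ℝ v y) * inner ℝ v y *
      (‖y‖ ^ 2 + ε ^ 2) ^ (-p) with hh
  have hinner : ∀ y ∈ Γ, |inner ℝ v y| ≤ 1 := fun y hy => by
    have := abs_real_inner_le_norm v y
    rw [hv, one_mul] at this
    exact this.trans ((hΓρ y hy).trans hρ.le)
  -- On A the profile is g itself, so h ε is g times a function that is continuous, and bounded on
  -- A.
  have hint : ∀ ε : ℝ, 0 < ε → IntegrableOn (h ε) A μHE[d] := by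
    intro ε hε
    have hgA : IntegrableOn g A μHE[d] := IntegrableOn.mono_set hg inter_subset_left
    have hcont : Continuous fun y : E => inner ℝ v y * (‖y‖ ^ 2 + ε ^ 2) ^ (-p) :=
      Continuous.mul (by fun_prop) ((by fun_prop : Continuous fun y : E =>
        ‖y‖ ^ 2 + ε ^ 2).rpow_const fun y => Or.inl (by positivity))
    have hb : IntegrableOn (fun y => (inner ℝ v y * (‖y‖ ^ 2 + ε ^ 2) ^ (-p)) * g y) A μHE[d] := by
      refine Integrable.bdd_mul (c := (ε ^ 2) ^ (-p)) hgA hcont.aestronglyMeasurable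
        (ae_restrict_of_forall_mem hAm fun y hy => ?_)
      rw [norm_mul, Real.norm_of_nonneg (show 0 ≤ (‖y‖ ^ 2 + ε ^ 2) ^ (-p) by positivity)]
      have h1 : (‖y‖ ^ 2 + ε ^ 2) ^ (-p) ≤ (ε ^ 2) ^ (-p) :=
        Real.rpow_le_rpow_of_nonpos (by positivity) (by nlinarith [norm_nonneg y]) (by linarith)
      calc _ ≤ 1 * (ε ^ 2) ^ (-p) :=
            mul_le_mul (hinner y hy.1) h1 (by positivity) zero_le_one
        _ = _ := one_mul _
    refine hb.congr_fun (fun y hy => ?_) hAm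
    simp only [hh, hgη y hy]
    ring
  have hI := tendsto_setIntegral_logProfile_atTop hE he hv hev (A := A) hflat.symm.subset hint
  -- The first summand bounds the singular kernel on Γ outside the half ball, at distance at least
  -- 1/4 from ε e when ε ≤ 1/4; the second bounds the Kelvin term on all of Γ.
  set L : ℝ := 2 * (1 / 4 : ℝ) ^ (-2 * p) + 2 * κ ^ (-p) with hL
  set G : ℝ := ∫ y in Γ, |g y| ∂μHE[d] with hG
  have hupper : ∀ ε ∈ Ioc (0 : ℝ) (1 / 4),
      fderiv ℝ (greenPotential p 0 (μHE[d].restrict Γ) g) (ε • e) v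
        ≤ L * G - 2 * ∫ y in A, h ε y ∂μHE[d] := by
    intro ε hε
    have hnorm : ‖ε • e‖ = ε := by rw [norm_smul, he, mul_one, Real.norm_of_nonneg hε.1.le]
    obtain ⟨hi, hder⟩ := hasFDerivAt_greenPotential_smul hp0 he hΓc hρ hΓρ hflat hg
      (ε := ε) ⟨hε.1, by linarith [hε.2]⟩
    rw [hder.fderiv, ContinuousLinearMap.integral_apply hi]
    have hi' : Integrable (fun y => (g y • greenKernelDeriv p (ε • e) y) v)
        (μHE[d].restrict Γ) := hi.apply_continuousLinearMap v
    have hind : Integrable (A.indicator (h ε)) (μHE[d].restrict Γ) :=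
      ((integrable_indicator_iff hAm).2 (hint ε hε.1)).restrict
    have hAΓ : ∫ y in Γ, A.indicator (h ε) y ∂μHE[d] = ∫ y in A, h ε y ∂μHE[d] := by
      rw [setIntegral_indicator hAm, inter_eq_right.2 inter_subset_left]
    rw [← hAΓ, hG, ← integral_const_mul, ← integral_const_mul,
      ← integral_sub (hg.abs.const_mul L) (hind.const_mul 2)]
    refine integral_mono_ae hi' ((hg.abs.const_mul L).sub (hind.const_mul 2))
      (ae_restrict_of_forall_mem hΓc.measurableSet fun y hy => ?_)
    simp only [smul_apply, smul_eq_mul, greenKernelDeriv_smul_apply p hev]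
    have hq : κ ≤ quad (‖y‖ ^ 2) 1 y (ε • e) :=
      quad_kelvin_ge hρ (by rw [hnorm]; linarith [hε.2]) (hΓρ y hy)
    have hq1 : quad (‖y‖ ^ 2) 1 y (ε • e) ^ (-p) ≤ κ ^ (-p) :=
      Real.rpow_le_rpow_of_nonpos hκ0 hq (by linarith)
    have hq0 : 0 ≤ quad (‖y‖ ^ 2) 1 y (ε • e) ^ (-p) := Real.rpow_nonneg (hκ0.le.trans hq) _
    have hregular : g y * (2 * quad (‖y‖ ^ 2) 1 y (ε • e) ^ (-p) * inner ℝ v y)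
        ≤ 2 * κ ^ (-p) * |g y| := by
      refine (le_abs_self _).trans ?_
      rw [abs_mul, abs_mul, abs_mul, abs_of_nonneg hq0, abs_two, mul_comm]
      refine mul_le_mul_of_nonneg_right ?_ (abs_nonneg _)
      calc _ ≤ 2 * κ ^ (-p) * 1 := by
            refine mul_le_mul (by linarith) (hinner y hy) (abs_nonneg _) (by positivity)
        _ = _ := mul_one _
    have hL1 : 0 ≤ 2 * (1 / 4 : ℝ) ^ (-2 * p) * |g y| := by positivity
    have hLg : L * |g y| = 2 * (1 / 4 : ℝ) ^ (-2 * p) * |g y| + 2 * κ ^ (-p) * |g y| := by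
      rw [hL]; ring
    by_cases hyA : y ∈ A
    · have hy0 : inner ℝ e y = 0 := (hflat.subset hyA).1
      have hsq : ‖ε • e - y‖ ^ (-2 * p) = (‖y‖ ^ 2 + ε ^ 2) ^ (-p) := by
        rw [norm_rpow_neg_two_mul, norm_sub_sq_real, inner_smul_left, hy0, hnorm]
        congr 1
        simp [add_comm]
      rw [indicator_of_mem hyA, hLg, hsq, mul_sub]
      have : g y * (2 * ((‖y‖ ^ 2 + ε ^ 2) ^ (-p) * inner ℝ v y)) = 2 * h ε y := by
        simp only [hh, hgη y hyA]; ring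
      linarith
    · rw [indicator_of_notMem hyA, hLg, mul_sub]
      have hyn : 1 / 2 ≤ ‖y‖ := by
        by_contra! hlt
        exact hyA ⟨hy, mem_ball_zero_iff.2 hlt⟩
      have hdist : 1 / 4 ≤ ‖ε • e - y‖ := by
        have h1 := norm_le_norm_add_norm_sub' y (ε • e)
        rw [norm_sub_rev, hnorm] at h1
        linarith [hε.2]
      have hd1 : ‖ε • e - y‖ ^ (-2 * p) ≤ (1 / 4 : ℝ) ^ (-2 * p) :=
        Real.rpow_le_rpow_of_nonpos (by norm_num) hdist (by linarith)
      have hsing : -(g y * (2 * (‖ε • e - y‖ ^ (-2 * p) * inner ℝ v y)))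
          ≤ 2 * (1 / 4 : ℝ) ^ (-2 * p) * |g y| := by
        refine (neg_le_abs _).trans ?_
        rw [abs_mul, abs_mul, abs_mul, abs_of_nonneg
          (show 0 ≤ ‖ε • e - y‖ ^ (-2 * p) by positivity), abs_two, mul_comm]
        refine mul_le_mul_of_nonneg_right ?_ (abs_nonneg _)
        have := mul_le_mul hd1 (hinner y hy) (abs_nonneg _) (by positivity)
        linarith
      linarith
  have hlim : Tendsto (fun ε : ℝ => L * G - 2 * ∫ y in A, h ε y ∂μHE[d]) (𝓝[>] 0) atBot := by
    have := tendsto_neg_atTop_atBot.comp (hI.const_mul_atTop (show (0 : ℝ) < 2 by norm_num))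
    simpa [sub_eq_add_neg, Function.comp_def] using tendsto_atBot_add_const_left _ (L * G) this
  refine tendsto_atBot_mono' _ ?_ hlim
  filter_upwards [Ioc_mem_nhdsGT (show (0 : ℝ) < 1 / 4 by norm_num)] with ε hε
  exact hupper ε hε

end Blowup

/-- A Lipschitz constant near 0 bounds the norm of `fderiv` at all nearby points; differentiability
is not needed, since the default value 0 obeys the same bound. -/
lemma not_locallyLipschitzOn_of_tendsto_fderiv_atBot {E : Type*} [NormedAddCommGroup E]
    [NormedSpace ℝ E] {u : E → ℝ} {Ω : Set E} (hΩ : IsOpen Ω) (h0 : (0 : E) ∈ Ω) {e v : E}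
    (h : Tendsto (fun ε : ℝ => fderiv ℝ u (ε • e) v) (𝓝[>] 0) atBot) :
    ¬ LocallyLipschitzOn Ω u := by
  intro hL
  obtain ⟨K, t, ht, hK⟩ := hL h0
  rw [hΩ.nhdsWithin_eq h0] at ht
  have hc : Tendsto (fun ε : ℝ => ε • e) (𝓝[>] 0) (𝓝 0) := by
    have : Continuous fun ε : ℝ => ε • e := by fun_prop
    simpa using (this.tendsto 0).mono_left (nhdsWithin_le_nhds (s := Ioi 0))
  have h1 : ∀ᶠ ε in 𝓝[>] (0 : ℝ), -(K * ‖v‖) ≤ fderiv ℝ u (ε • e) v := by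
    filter_upwards [hc.eventually (eventually_mem_nhds_iff.2 ht)] with ε hε
    have h2 := norm_fderiv_le_of_lipschitzOn ℝ hε hK
    have h3 := (fderiv ℝ u (ε • e)).le_of_opNorm_le h2 v
    rw [Real.norm_eq_abs] at h3
    exact (abs_le.1 h3).1
  obtain ⟨ε, h2, h3⟩ := (h1.and (h.eventually_lt_atBot (-(K * ‖v‖)))).exists
  linarith

/-! ### The theorem. -/

theorem theorem3p2 (n : ℕ) (hn : 2 ≤ n)
    (Γ : Set (EuclideanSpace ℝ (Fin n)))
    (hΓ : IsSmoothClosedHypersurface Γ)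
    (hΓball : Γ ⊆ Metric.ball 0 1)
    (hΓflat : Γ ∩ Metric.ball 0 (1 / 2) =
      {x | x ⟨n - 1, by omega⟩ = 0} ∩ Metric.ball 0 (1 / 2))
    (g : EuclideanSpace ℝ (Fin n) → ℝ)
    (hg : MemLp g ⊤ (μHE[n - 1].restrict Γ))
    (hgη : ∀ x ∈ Γ ∩ Metric.ball 0 (1 / 2), g x = logProfile (x ⟨0, by omega⟩)) :
    ∃ u : EuclideanSpace ℝ (Fin n) → ℝ,
      IsDistributionalSolution (Metric.ball 0 1) Γ g u ∧
      (∀ v, IsDistributionalSolution (Metric.ball 0 1) Γ g v →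
        EqOn v u (Metric.closedBall 0 1)) ∧
      ¬ LocallyLipschitzOn (Metric.ball 0 1) u ∧
      (∀ ε ∈ Ioo (0 : ℝ) (1 / 2),
        DifferentiableAt ℝ u (ε • EuclideanSpace.single ⟨n - 1, by omega⟩ 1)) ∧
      Tendsto
        (fun ε : ℝ => fderiv ℝ u (ε • EuclideanSpace.single ⟨n - 1, by omega⟩ 1)
          (EuclideanSpace.single ⟨0, by omega⟩ 1))
        (𝓝[>] 0) atBot := by
  obtain ⟨d, rfl⟩ : ∃ d, n = d + 1 := ⟨n - 1, by omega⟩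
  have hd : d ≠ 0 := by omega
  simp only [Nat.add_sub_cancel] at hg
  have hE : Module.finrank ℝ (EuclideanSpace ℝ (Fin (d + 1))) = d + 1 := by simp
  have : Nontrivial (EuclideanSpace ℝ (Fin (d + 1))) := Module.nontrivial_of_finrank_pos (R := ℝ) (by omega)
  set e : EuclideanSpace ℝ (Fin (d + 1)) := EuclideanSpace.single ⟨d + 1 - 1, by omega⟩ 1 with he
  set v : EuclideanSpace ℝ (Fin (d + 1)) := EuclideanSpace.single ⟨0, by omega⟩ 1 with hv
  have he1 : ‖e‖ = 1 := by simp [he]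
  have hv1 : ‖v‖ = 1 := by simp [hv]
  have hie : ∀ x : EuclideanSpace ℝ (Fin (d + 1)), inner ℝ e x = x ⟨d + 1 - 1, by omega⟩ := fun x => by
    simp [he, EuclideanSpace.inner_single_left]
  have hiv : ∀ x : EuclideanSpace ℝ (Fin (d + 1)), inner ℝ v x = x ⟨0, by omega⟩ := fun x => by
    simp [hv, EuclideanSpace.inner_single_left]
  have hev : inner ℝ e v = 0 := by
    rw [hie, hv]
    simp [hd]
  have hΓc : IsClosed Γ := hΓ.1.isClosed
  -- Γ is closed inside the open unit ball, so it lies in a strictly smaller ball; this keeps the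
  -- Kelvin term regular.
  obtain ⟨ρ, hρ, hΓρ'⟩ := exists_lt_subset_ball hΓc hΓball
  have hΓρ : ∀ y ∈ Γ, ‖y‖ ≤ ρ := fun y hy => (mem_ball_zero_iff.1 (hΓρ' hy)).le
  have hμρ : ∀ᵐ y ∂(μHE[d].restrict Γ), ‖y‖ ≤ ρ :=
    ae_restrict_of_forall_mem hΓc.measurableSet hΓρ
  obtain ⟨C, hC, hgrow'⟩ := hΓ.exists_growth hE
  have hgrow : HasGrowth (μHE[d].restrict Γ) d C := hgrow'
  have : IsFiniteMeasure (μHE[d].restrict Γ) := by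
    refine ⟨?_⟩
    have h1 : (μHE[d].restrict Γ) univ ≤ (μHE[d].restrict Γ) (Metric.ball 0 1) := by
      rw [Measure.restrict_apply_univ, Measure.restrict_apply Metric.isOpen_ball.measurableSet,
        inter_eq_right.2 hΓball]
    exact (h1.trans (hgrow 0 1 one_pos)).trans_lt (ENNReal.mul_lt_top hC.lt_top
      ENNReal.ofReal_lt_top)
  have hgi : Integrable g (μHE[d].restrict Γ) := hg.integrable le_top
  -- The mass of the point source produced by the unnormalized kernel; dividing by it gives the
  -- solution.
  set c : ℝ := ∫ x, bubble (EuclideanSpace ℝ (Fin (d + 1))) x with hc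
  have hc0 : 0 < c := integral_bubble_pos
  have hflat : Γ ∩ Metric.ball 0 (1 / 2) = {x | inner ℝ e x = 0} ∩ Metric.ball 0 (1 / 2) := by
    simp only [hie]; exact hΓflat
  have hgη' : ∀ y ∈ Γ ∩ Metric.ball 0 (1 / 2), g y = logProfile (inner ℝ v y) := fun y hy => by
    rw [hiv]; exact hgη y hy
  set p : ℝ := (d + 1 : ℝ) / 2 with hp
  have hp0 : 0 ≤ p := by positivity
  set w : EuclideanSpace ℝ (Fin (d + 1)) → ℝ := greenPotential p 0 (μHE[d].restrict Γ) g with hw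
  have hclos : closure (Metric.ball (0 : EuclideanSpace ℝ (Fin (d + 1))) 1) = Metric.closedBall 0 1 :=
    closure_ball 0 one_ne_zero
  have hfront : frontier (Metric.ball (0 : EuclideanSpace ℝ (Fin (d + 1))) 1) = Metric.sphere 0 1 :=
    frontier_ball 0 one_ne_zero
  have hdiff : ∀ ε ∈ Ioo (0 : ℝ) (1 / 2), DifferentiableAt ℝ w (ε • e) := fun ε hε =>
    (hasFDerivAt_greenPotential_smul hp0 he1 hΓc hρ hΓρ hflat hgi hε).2.differentiableAt
  have hsol : IsDistributionalSolution (Metric.ball 0 1) Γ g (fun x => c⁻¹ * w x) := by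
    refine ⟨?_, fun x hx => ?_, fun φ hφ hφc hφs => ?_⟩
    · rw [hclos]
      exact continuousOn_const.mul (hgrow.continuousOn_greenPotential hd hC hρ hμρ hg)
    · rw [hfront, mem_sphere_zero_iff_norm] at hx
      simp only [hw, greenPotential_of_norm_eq_one p 0 _ g hx, mul_zero]
    · have key := hgrow.integral_greenPotential_mul_laplacian (ν := volume) hd hC hE hρ hμρ hg
        (hφ.of_le (WithTop.coe_le_coe.2 le_top)) hφc hφs
      simp_rw [mul_assoc]
      rw [integral_const_mul, key, ← mul_assoc, inv_mul_cancel₀ hc0.ne', one_mul]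
      rfl
  have htend : Tendsto (fun ε : ℝ => fderiv ℝ (fun x => c⁻¹ * w x) (ε • e) v)
      (𝓝[>] 0) atBot := by
    have h1 := tendsto_fderiv_greenPotential_atBot hE he1 hv1 hev hΓc hρ hΓρ hflat hgi hgη'
    refine (h1.const_mul_atBot (inv_pos.2 hc0)).congr' ?_
    filter_upwards [Ioo_mem_nhdsGT (show (0 : ℝ) < 1 / 2 by norm_num)] with ε hε
    rw [fderiv_const_mul (hdiff ε hε)]
    rfl
  refine ⟨fun x => c⁻¹ * w x, hsol, fun z hz => ?_, ?_, fun ε hε => (hdiff ε hε).const_mul _,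
    htend⟩
  · intro x hx
    have hsub : ContinuousOn (fun x => z x - c⁻¹ * w x) (closure (Metric.ball 0 1)) :=
      hz.1.sub hsol.1
    refine sub_eq_zero.1 (eq_zero_of_integral_mul_laplacian_eq_zero (μ := volume)
      (w := fun x => z x - c⁻¹ * w x) Metric.isOpen_ball Metric.isBounded_ball hsub
      (fun y hy => ?_) (fun φ hφ hφc hφs => ?_) (hclos ▸ hx))
    · rw [hz.2.1 y hy]
      have := hsol.2.1 y hy
      simp only at this
      rw [this, sub_zero]
    · have hΔc := continuous_laplacian (hφ.of_le (m := 2) (WithTop.coe_le_coe.2 le_top))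
      have hi : ∀ f : EuclideanSpace ℝ (Fin (d + 1)) → ℝ, ContinuousOn f (closure (Metric.ball 0 1)) →
          IntegrableOn (fun x => f x * Laplacian.laplacian φ x) (Metric.ball 0 1) volume := by
        intro f hf
        rw [hclos] at hf
        exact ((hf.mul hΔc.continuousOn).integrableOn_compact
          (isCompact_closedBall 0 1)).mono_set Metric.ball_subset_closedBall
      simp_rw [sub_mul]
      rw [integral_sub (hi _ hz.1) (hi _ hsol.1), hz.2.2 φ hφ hφc hφs, hsol.2.2 φ hφ hφc hφs,
        sub_self]
  · exact not_locallyLipschitzOn_of_tendsto_fderiv_atBot Metric.isOpen_ball (by simp) htend
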